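/- Let $C=(c_{ij})_{i,j\ge 1}$ be an infinite symmetric matrix with entries in $\mathbb Z_2=\{0,1\}$ (the two-element field) and zeros on the diagonal. Let $\Gamma$ be the $\mathbb Z_2$-vector space of all sequences $x=(x_1,x_2,\dots)$ in $\mathbb Z_2$ that vanish eventually, let $\omega(x,y)=\sum_{i,j}c_{ij}x_jy_i$ for $x,y\in\Gamma$, and let $\ker\omega=\{x\in\Gamma:\omega(x,y)=0\text{ for all }y\in\Gamma\}$. Assume that $C$ has infinite rank, i.e. that its columns span an infinite-dimensional subspace of $\mathbb Z_2^\infty$. An irreducible spin system with commutation matrix $C$ is a sequence $\bar U=(U_1,U_2,\dots)$ of self-adjoint unitary operators on a complex Hilbert space $H\neq\{0\}$ such that $U_iU_j=(-1)^{c_{ij}}U_jU_i$ for all $i,j$ and such that $\{0\}$ and $H$ are the only closed subspaces of $H$ invariant under all $U_k$. Two such systems $\bar U$ on $H$ and $\bar V$ on $K$ are called equivalent (approximately unitarily equivalent) if there is a sequence of unitary operators $W_1,W_2,\dots:H\to K$ with $\lim_{n\to\infty}\|W_nU_kW_n^{-1}-V_k\|=0$ for every $k$. For $\gamma\in\mathbb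 Z_2^\infty$ let $\bar U^\gamma=((-1)^{\gamma_1}U_1,(-1)^{\gamma_2}U_2,\dots)$, which is again an irreducible spin system with commutation matrix $C$. Theorem. (1) Let $\bar U$ be any irreducible spin system with commutation matrix $C$. Every irreducible spin system with commutation matrix $C$ is equivalent to $\bar U^\gamma$ for some $\gamma\in\mathbb Z_2^\infty$. For $\gamma,\gamma'\in\mathbb Z_2^\infty$, the systems $\bar U^\gamma$ and $\bar U^{\gamma'}$ are equivalent if and only if $\gamma$ and $\gamma'$ define the same linear functional on $\ker\omega$, that is, $\sum_k\gamma_kx_k=\sum_k\gamma'_kx_k$ for all $x\in\ker\omega$. (2) If $\ker\omega$ has finite dimension $d$ over $\mathbb Z_2$, then there are exactly $2^d$ equivalence classes of irreducible spin systems with commutation matrix $C$. If $\ker\omega$ is infinite-dimensional, then the set of equivalence classes has the cardinality $2^{\aleph_0}$ of the continuum. -/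

import Mathlib

open Filter Topology

universe u v w

noncomputable section

namespace SpinSystem

/-- The free vector space over the two-element field on a countable basis: sequences in
`ZMod 2` that vanish eventually. -/
abbrev Gam : Type := ℕ →₀ ZMod 2

/-- The bilinear form `ω(x, y) = ∑ i j, c i j * x j * y i` on `Gam`
(see `omega_apply` for the explicit formula). -/
def omega (c : Matrix ℕ ℕ (ZMod 2)) : Gam →ₗ[ZMod 2] Gam →ₗ[ZMod 2] ZMod 2 :=
  Finsupp.linearCombination (ZMod 2) fun j =>
    Finsupp.linearCombination (ZMod 2) fun i => c i j

theorem omega_apply (c : Matrix ℕ ℕ (ZMod 2)) (x y : Gam) :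
    omega c x y = ∑ i ∈ y.support, ∑ j ∈ x.support, c i j * x j * y i := by
  rw [Finset.sum_comm]
  simp only [omega, Finsupp.linearCombination_apply, Finsupp.sum, LinearMap.sum_apply,
    LinearMap.smul_apply, smul_eq_mul, Finset.mul_sum]
  refine Finset.sum_congr rfl fun j _ => Finset.sum_congr rfl fun i _ => ?_
  ring

/-- `ker ω = {x | ω(x, y) = 0 for all y}`. -/
def kerOmega (c : Matrix ℕ ℕ (ZMod 2)) : Submodule (ZMod 2) Gam :=
  LinearMap.ker (omega c)

/-- The linear functional `x ↦ ∑ k, γ k * x k` defined by a sequence `γ`. -/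
def functional (γ : ℕ → ZMod 2) (x : Gam) : ZMod 2 :=
  ∑ k ∈ x.support, γ k * x k

/-- The sign `(-1) ^ a` for `a` in the two-element field. -/
def sgn (a : ZMod 2) : ℂ := (-1) ^ a.val

theorem sgn_eq (a : ZMod 2) : sgn a = 1 ∨ sgn a = -1 := neg_one_pow_eq_or ℂ _

theorem sgn_mul_self (a : ZMod 2) : sgn a * sgn a = 1 := by
  rcases sgn_eq a with h | h <;> simp [h]

theorem star_sgn (a : ZMod 2) : star (sgn a) = sgn a := by
  rcases sgn_eq a with h | h <;> simp [h]

section Operators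

variable {H : Type u} [NormedAddCommGroup H] [InnerProductSpace ℂ H] [CompleteSpace H]

/-- A sequence of bounded operators on a Hilbert space is irreducible if the space is not zero
and `0` and the whole space are the only closed subspaces invariant under every operator of the
sequence. -/
structure IsIrreducible (U : ℕ → H →L[ℂ] H) : Prop where
  nontrivial : Nontrivial H
  invariant : ∀ M : Submodule ℂ H, IsClosed (M : Set H) →
    (∀ k, ∀ ξ ∈ M, U k ξ ∈ M) → M = ⊥ ∨ M = ⊤

/-- A sequence of self-adjoint unitary operators with `U i U j = (-1) ^ (c i j) U j U i`. -/
structure IsSpinSystem (c : Matrix ℕ ℕ (ZMod 2)) (U : ℕ → H →L[ℂ] H) : Prop where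
  isSelfAdjoint : ∀ k, IsSelfAdjoint (U k)
  mem_unitary : ∀ k, U k ∈ unitary (H →L[ℂ] H)
  comm : ∀ i j, U i * U j = sgn (c i j) • (U j * U i)

end Operators

/-- An irreducible spin system on a complex Hilbert space with commutation matrix `c`. -/
structure IrreducibleSpinSystem (c : Matrix ℕ ℕ (ZMod 2)) : Type (u + 1) where
  /-- the Hilbert space -/
  H : Type u
  [normedAddCommGroup : NormedAddCommGroup H]
  [innerProductSpace : InnerProductSpace ℂ H]
  [completeSpace : CompleteSpace H]
  /-- the sequence of operators -/
  U : ℕ → H →L[ℂ] H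
  isSpinSystem : IsSpinSystem c U
  isIrreducible : IsIrreducible U

namespace IrreducibleSpinSystem

attribute [instance] normedAddCommGroup innerProductSpace completeSpace

variable {c : Matrix ℕ ℕ (ZMod 2)}

/-- Multiply the `k`-th operator of a spin system by the sign `(-1) ^ (γ k)`. -/
def phaseShift (S : IrreducibleSpinSystem.{u} c) (γ : ℕ → ZMod 2) :
    IrreducibleSpinSystem.{u} c where
  H := S.H
  U := fun k => sgn (γ k) • S.U k
  isSpinSystem :=
    { isSelfAdjoint := fun k => by
        have h := (S.isSpinSystem.isSelfAdjoint k).star_eq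
        rw [isSelfAdjoint_iff, star_smul, star_sgn, h]
      mem_unitary := fun k => by
        have h := Unitary.mem_iff.1 (S.isSpinSystem.mem_unitary k)
        rw [Unitary.mem_iff, star_smul, star_sgn]
        simp only [smul_mul_smul_comm, sgn_mul_self, h.1, h.2, one_smul, and_self]
      comm := fun i j => by
        rw [smul_mul_smul_comm, smul_mul_smul_comm, S.isSpinSystem.comm i j, smul_smul, smul_smul]
        congr 1
        ring }
  isIrreducible :=
    { nontrivial := S.isIrreducible.nontrivial
      invariant := fun M hM hinv => S.isIrreducible.invariant M hM fun k ξ hξ => by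
        have h := M.smul_mem (sgn (γ k)) (hinv k ξ hξ)
        rwa [smul_apply, smul_smul, sgn_mul_self, one_smul] at h }

/-- Approximate unitary equivalence: there are unitary operators `W 0, W 1, …` from the first
Hilbert space onto the second with `‖W n U k (W n)⁻¹ - V k‖ → 0` as `n → ∞`, for every `k`. -/
def Equivalent (S : IrreducibleSpinSystem.{u} c) (T : IrreducibleSpinSystem.{v} c) : Prop :=
  ∃ W : ℕ → S.H ≃ₗᵢ[ℂ] T.H, ∀ k, Tendsto
    (fun n => ‖((W n : S.H →L[ℂ] T.H) ∘L S.U k ∘L ((W n).symm : T.H →L[ℂ] S.H)) - T.U k‖)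
    atTop (𝓝 0)

theorem Equivalent.refl (S : IrreducibleSpinSystem.{u} c) : S.Equivalent S := by
  refine ⟨fun _ => LinearIsometryEquiv.refl ℂ S.H, fun k => ?_⟩
  refine tendsto_const_nhds.congr fun n => ?_
  symm
  rw [norm_eq_zero, sub_eq_zero]
  ext ξ
  simp

theorem norm_conj_le {H : Type u} {K : Type v} [NormedAddCommGroup H] [InnerProductSpace ℂ H]
    [NormedAddCommGroup K] [InnerProductSpace ℂ K] (W : H ≃ₗᵢ[ℂ] K) (A : H →L[ℂ] H) :
    ‖(W : H →L[ℂ] K) ∘L A ∘L (W.symm : K →L[ℂ] H)‖ ≤ ‖A‖ := by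
  refine ContinuousLinearMap.opNorm_le_bound _ (norm_nonneg _) fun ξ => ?_
  simpa using A.le_opNorm (W.symm ξ)

theorem Equivalent.symm {S : IrreducibleSpinSystem.{u} c} {T : IrreducibleSpinSystem.{v} c}
    (h : S.Equivalent T) : T.Equivalent S := by
  obtain ⟨W, hW⟩ := h
  refine ⟨fun n => (W n).symm, fun k => ?_⟩
  refine squeeze_zero (fun _ => norm_nonneg _) (fun n => ?_) (hW k)
  rw [norm_sub_rev]
  refine le_trans (le_of_eq ?_) (norm_conj_le (W n).symm _)
  congr 1
  ext ξ
  simp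

theorem Equivalent.trans {S : IrreducibleSpinSystem.{u} c} {T : IrreducibleSpinSystem.{v} c}
    {R : IrreducibleSpinSystem.{w} c} (h : S.Equivalent T) (h' : T.Equivalent R) :
    S.Equivalent R := by
  obtain ⟨W, hW⟩ := h
  obtain ⟨W', hW'⟩ := h'
  refine ⟨fun n => (W n).trans (W' n), fun k => ?_⟩
  have hsum := (hW k).add (hW' k)
  rw [add_zero] at hsum
  refine squeeze_zero (fun _ => norm_nonneg _) (fun n => ?_) hsum
  refine le_trans (le_of_eq ?_) (le_trans (norm_add_le _ _)
    (add_le_add_left (norm_conj_le (W' n) _) _))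
  congr 1
  ext ξ
  simp

/-- Approximate unitary equivalence as an equivalence relation on the irreducible spin systems
with commutation matrix `c`. -/
def setoid (c : Matrix ℕ ℕ (ZMod 2)) : Setoid (IrreducibleSpinSystem.{u} c) where
  r := Equivalent
  iseqv := ⟨Equivalent.refl, Equivalent.symm, Equivalent.trans⟩

/-- The equivalence classes of irreducible spin systems with commutation matrix `c`. -/
def Classes (c : Matrix ℕ ℕ (ZMod 2)) : Type (u + 1) :=
  Quotient (setoid.{u} c)

end IrreducibleSpinSystem

end SpinSystem

end

/-!
Write `β` for the strictly lower triangular part of `ω`, so that `ω x y = β x y + β y x`. Ordered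
products of the operators of a spin system form a projective unitary representation `A` of the
vector space `Gam` with `A x * A y = (-1) ^ β x y • A (x + y)`, here called a Weyl system
(`IsSpinSystem.exists_isWeylSystem`). If the spin system is irreducible, then `A x` is a scalar
`z x` for `x ∈ ker ω`. The whole classification is by this central character `z`.

*Uniqueness.* Let two irreducible Weyl systems have the same central character, and fix a finite
subspace of `Gam`. Enlarge it to a finite subspace `F` whose radical lies in `ker ω`
(`exists_finite_radical_le`) and let `L` be a maximal isotropic subspace of `F`. The commuting
operators `A l`, `l ∈ L`, have joint eigenspaces, and the operators `A y`, `y ∈ F`, permute those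
eigenspaces that are compatible with `z` transitively
(`IsWeylSystem.exists_mem_jointEigenspace`). The Hilbert space is separable, and it is
infinite-dimensional because `ω` has infinite rank, so that each eigenspace has a countably
infinite orthonormal basis. The translates under `F` of such a basis are total, and by maximality
of `L` their Gram matrix depends on the eigenvalues only (`IsWeylSystem.inner_map_eigenvectors`).
Hence some unitary operator intertwines the two systems exactly on `F`
(`IsWeylSystem.exists_intertwiner`). As this holds for the span of the first `n` basis vectors,
for every `n`, the systems are approximately unitarily equivalent. Conversely, the scalars `z x`
pass to the limit of unitary conjugates.

*Phase shifts.* The shift by `γ` multiplies `z x` by `(-1) ^ ∑ γ k * x k`, and two central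
characters differ by a sign that is additive in `x`, that is, by a linear functional on `ker ω`,
which extends to `Gam`.

*Counting.* The equivalence classes thus correspond to the functionals on `ker ω` as soon as one
irreducible spin system exists. One is induced from a maximal isotropic subspace `Λ` of `Gam`: it
acts by shifts with signs on an orthonormal basis indexed by a complement of `Λ`
(`exists_induced_operators`), and it is irreducible since the operators of `Λ` are diagonal in this
basis with pairwise distinct systems of eigenvalues (`induced_irreducible`).
-/

namespace SpinSystem

/-! ### Signs -/

theorem sgn_zero : sgn 0 = 1 := by simp [sgn]

theorem sgn_one : sgn 1 = -1 := by simp [sgn, ZMod.val_one]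

theorem zmod_two_cases (a : ZMod 2) : a = 0 ∨ a = 1 := by
  fin_cases a
  · exact Or.inl rfl
  · exact Or.inr rfl

theorem sgn_add (a b : ZMod 2) : sgn (a + b) = sgn a * sgn b := by
  rcases zmod_two_cases a with rfl | rfl <;> rcases zmod_two_cases b with rfl | rfl <;>
    simp [sgn_zero, sgn_one, CharTwo.add_self_eq_zero]

theorem sgn_ne_zero (a : ZMod 2) : sgn a ≠ 0 := by
  rcases sgn_eq a with h | h <;> simp [h]

theorem sgn_eq_one_iff {a : ZMod 2} : sgn a = 1 ↔ a = 0 := by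
  rcases zmod_two_cases a with rfl | rfl
  · simp [sgn_zero]
  · simp only [sgn_one, one_ne_zero, iff_false]
    norm_num

theorem sgn_injective : Function.Injective sgn := by
  intro a b h
  have h1 : sgn (a + b) = 1 := by rw [sgn_add, h, sgn_mul_self]
  have h2 := sgn_eq_one_iff.1 h1
  rwa [CharTwo.add_eq_zero] at h2

theorem norm_sgn (a : ZMod 2) : ‖sgn a‖ = 1 := by
  rcases sgn_eq a with h | h <;> simp [h]

/-- Two complex numbers with the same square differ by a sign. -/
theorem exists_eq_sgn_mul {a b : ℂ} (h : a ^ 2 = b ^ 2) : ∃ e : ZMod 2, a = sgn e * b := by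
  rcases sq_eq_sq_iff_eq_or_eq_neg.1 h with h | h
  · exact ⟨0, by simp [h, sgn_zero]⟩
  · exact ⟨1, by simp [h, sgn_one]⟩

/-! ### Alternating forms over the two-element field -/

section Forms

variable {E : Type*} [AddCommGroup E] [Module (ZMod 2) E]

theorem exists_maximal_isotropic (ω : E →ₗ[ZMod 2] E →ₗ[ZMod 2] ZMod 2)
    (hsymm : ∀ x y, ω x y = ω y x) (halt : ∀ x, ω x x = 0) (F : Submodule (ZMod 2) E) :
    ∃ L ≤ F, (∀ x ∈ L, ∀ y ∈ L, ω x y = 0) ∧ ∀ x ∈ F, (∀ l ∈ L, ω x l = 0) → x ∈ L := by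
  obtain ⟨L, hL⟩ := zorn_le₀
    {L : Submodule (ZMod 2) E | L ≤ F ∧ ∀ x ∈ L, ∀ y ∈ L, ω x y = 0} (by
      intro C hC hchain
      rcases C.eq_empty_or_nonempty with rfl | hne
      · exact ⟨⊥, ⟨bot_le, by simp⟩, by simp⟩
      · refine ⟨sSup C, ⟨sSup_le fun L hL => (hC hL).1, ?_⟩, fun L hL => le_sSup hL⟩
        intro x hx y hy
        rw [Submodule.mem_sSup_of_directed hne hchain.directedOn] at hx hy
        obtain ⟨L₁, h₁, hx⟩ := hx
        obtain ⟨L₂, h₂, hy⟩ := hy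
        rcases hchain.total h₁ h₂ with h | h
        · exact (hC h₂).2 x (h hx) y hy
        · exact (hC h₁).2 x hx y (h hy))
  refine ⟨L, hL.prop.1, hL.prop.2, fun x hxF hx => ?_⟩
  -- `L + ⟨x⟩` is isotropic, so it is contained in `L` by maximality.
  have hle : L ⊔ Submodule.span (ZMod 2) {x} ≤ L := by
    refine hL.le_of_ge ⟨sup_le hL.prop.1 ?_, ?_⟩ le_sup_left
    · rwa [Submodule.span_singleton_le_iff_mem]
    · intro y hy z hz
      obtain ⟨l, hl, m, hm, rfl⟩ := Submodule.mem_sup.1 hy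
      obtain ⟨a, rfl⟩ := Submodule.mem_span_singleton.1 hm
      obtain ⟨l', hl', m', hm', rfl⟩ := Submodule.mem_sup.1 hz
      obtain ⟨b, rfl⟩ := Submodule.mem_span_singleton.1 hm'
      simp [hL.prop.2 l hl l' hl', hx l' hl', hsymm l x, hx l hl, halt x]
  exact hle (Submodule.mem_sup_right (Submodule.mem_span_singleton_self x))

/-- A finite subspace lies in a finite subspace whose radical consists of vectors of the radical
of the whole space: a vector `r` of the radical of `F` with `ω r y = 1` for some `y` is removed
from the radical by adjoining `y` to `F`, and no new vector enters the radical. -/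
theorem exists_finite_radical_le (ω : E →ₗ[ZMod 2] E →ₗ[ZMod 2] ZMod 2)
    (hsymm : ∀ x y, ω x y = ω y x) (F₀ : Submodule (ZMod 2) E)
    (hF₀ : (F₀ : Set E).Finite) :
    ∃ F, F₀ ≤ F ∧ (F : Set E).Finite ∧ ∀ x ∈ F, (∀ y ∈ F, ω x y = 0) → ω x = 0 := by
  induction h : Set.ncard {x | x ∈ F₀ ∧ ∀ y ∈ F₀, ω x y = 0} using Nat.strong_induction_on
    generalizing F₀ with
  | _ n ih =>
    by_cases hrad : ∀ x ∈ F₀, (∀ y ∈ F₀, ω x y = 0) → ω x = 0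
    · exact ⟨F₀, le_rfl, hF₀, hrad⟩
    push Not at hrad
    obtain ⟨r, hr, hr0, hrne⟩ := hrad
    obtain ⟨y, hy⟩ : ∃ y, ω r y ≠ 0 := by
      by_contra! hcon
      exact hrne (LinearMap.ext hcon)
    have hfin : ((F₀ ⊔ Submodule.span (ZMod 2) {y} : Submodule (ZMod 2) E) : Set E).Finite := by
      rw [Submodule.coe_sup]
      refine hF₀.add ?_
      have : (Submodule.span (ZMod 2) {y} : Set E) = Set.range fun a : ZMod 2 => a • y := by
        ext; simp [Submodule.mem_span_singleton]
      rw [this]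
      exact Set.finite_range _
    obtain ⟨F, hle, hF⟩ := ih _ (by
      rw [← h]
      refine Set.ncard_lt_ncard ?_ (hF₀.subset fun x hx => hx.1)
      refine ⟨?_, ?_⟩
      · rintro x ⟨hx, hx'⟩
        obtain ⟨l, hl, m, hm, rfl⟩ := Submodule.mem_sup.1 hx
        obtain ⟨a, rfl⟩ := Submodule.mem_span_singleton.1 hm
        have ha : a = 0 := by
          have h1 := hx' r (Submodule.mem_sup_left hr)
          rw [map_add, LinearMap.add_apply, hsymm l r, hr0 l hl, map_smul, LinearMap.smul_apply,
            hsymm y r, zero_add, smul_eq_mul] at h1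
          exact (mul_eq_zero.1 h1).resolve_right hy
        subst ha
        simp only [zero_smul, add_zero] at hx' ⊢
        exact ⟨hl, fun z hz => hx' z (Submodule.mem_sup_left hz)⟩
      · intro hcon
        exact hy ((hcon ⟨hr, hr0⟩).2 y
          (Submodule.mem_sup_right (Submodule.mem_span_singleton_self y)))) _ hfin rfl
    exact ⟨F, le_sup_left.trans hle, hF⟩

/-- A functional on a subspace `L` of `F` that vanishes on the radical is represented by a vector
of `F`, provided the radical of `F` is contained in that of the whole space. -/
theorem exists_eq_form_of_vanish (ω : E →ₗ[ZMod 2] E →ₗ[ZMod 2] ZMod 2)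
    {F : Submodule (ZMod 2) E} (hF : (F : Set E).Finite)
    (hrad : ∀ x ∈ F, (∀ y ∈ F, ω x y = 0) → ω x = 0) {L : Submodule (ZMod 2) E} (hLF : L ≤ F)
    (f : L →ₗ[ZMod 2] ZMod 2) (hf : ∀ l : L, ω l = 0 → f l = 0) :
    ∃ y ∈ F, ∀ l : L, f l = ω l y := by
  have : Finite F := hF
  let Φ : F →ₗ[ZMod 2] (L →ₗ[ZMod 2] ZMod 2) :=
    (LinearMap.lcomp (ZMod 2) (ZMod 2) L.subtype) ∘ₗ ω.flip ∘ₗ F.subtype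
  have hΦ : ∀ y l, Φ y l = ω l y := fun y l => rfl
  have hmem : f ∈ Submodule.span (ZMod 2) (Set.range Φ) := by
    refine mem_span_of_iInf_ker_le_ker fun l hl => ?_
    simp only [Submodule.mem_iInf, LinearMap.mem_ker] at hl ⊢
    exact hf l (hrad l (hLF l.2) fun y hy => hl ⟨y, hy⟩)
  rw [← LinearMap.coe_range, Submodule.span_eq] at hmem
  obtain ⟨y, rfl⟩ := hmem
  exact ⟨y, y.2, fun l => hΦ y l⟩

end Forms

/-! ### Total families with equal Gram matrices -/

theorem denseRange_linearCombination {ι H : Type*} [NormedAddCommGroup H] [InnerProductSpace ℂ H]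
    {a : ι → H} (ha : Dense (Submodule.span ℂ (Set.range a) : Set H)) :
    DenseRange (Finsupp.linearCombination ℂ a) := by
  rwa [DenseRange, ← LinearMap.coe_range, Finsupp.range_linearCombination]

/-- Total families with the same Gram matrix are carried to each other by a unitary operator. -/
theorem exists_isometryEquiv_of_inner_eq {ι H K : Type*} [NormedAddCommGroup H]
    [InnerProductSpace ℂ H] [CompleteSpace H] [NormedAddCommGroup K] [InnerProductSpace ℂ K]
    [CompleteSpace K] {a : ι → H} {b : ι → K}
    (ha : Dense (Submodule.span ℂ (Set.range a) : Set H))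
    (hb : Dense (Submodule.span ℂ (Set.range b) : Set K))
    (h : ∀ i j, inner ℂ (a i) (a j) = inner ℂ (b i) (b j)) :
    ∃ W : H ≃ₗᵢ[ℂ] K, ∀ i, W (a i) = b i := by
  have ha' := denseRange_linearCombination ha
  have hb' := denseRange_linearCombination hb
  have hnorm : ∀ x, ‖Finsupp.linearCombination ℂ b (LinearEquiv.refl ℂ (ι →₀ ℂ) x)‖ =
      ‖Finsupp.linearCombination ℂ a x‖ := by
    intro x
    have hsq : inner ℂ (Finsupp.linearCombination ℂ b x) (Finsupp.linearCombination ℂ b x) =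
        inner ℂ (Finsupp.linearCombination ℂ a x) (Finsupp.linearCombination ℂ a x) := by
      simp only [Finsupp.linearCombination_apply, Finsupp.sum, sum_inner, inner_sum,
        inner_smul_left, inner_smul_right, h]
    rw [inner_self_eq_norm_sq_to_K, inner_self_eq_norm_sq_to_K] at hsq
    have hsq' : ‖Finsupp.linearCombination ℂ b x‖ ^ 2 = ‖Finsupp.linearCombination ℂ a x‖ ^ 2 := by
      exact_mod_cast hsq
    exact (sq_eq_sq₀ (norm_nonneg _) (norm_nonneg _)).1 hsq'
  refine ⟨(LinearEquiv.refl ℂ (ι →₀ ℂ)).extendOfIsometry _ _ ha' hb' hnorm, fun i => ?_⟩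
  have h1 := LinearEquiv.extendOfIsometry_eq (LinearEquiv.refl ℂ (ι →₀ ℂ)) _ _ ha' hb' hnorm
    (Finsupp.single i 1)
  simpa using h1

/-- An infinite-dimensional separable Hilbert space has an orthonormal basis indexed by `ℕ`. -/
theorem exists_hilbertBasis_nat {H : Type*} [NormedAddCommGroup H] [InnerProductSpace ℂ H]
    [CompleteSpace H] [TopologicalSpace.SeparableSpace H] (hH : ¬ FiniteDimensional ℂ H) :
    ∃ a : ℕ → H, Orthonormal ℂ a ∧ Dense (Submodule.span ℂ (Set.range a) : Set H) := by
  obtain ⟨s, b, hb⟩ := exists_hilbertBasis ℂ H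
  have hon : Orthonormal ℂ ((↑) : s → H) := hb ▸ b.orthonormal
  have hcount : Countable s := by
    refine Pairwise.countable_of_isOpen_disjoint (s := fun x : s => Metric.ball (x : H) (1 / 2))
      (fun x y hxy => Metric.ball_disjoint_ball ?_) (fun _ => Metric.isOpen_ball)
      fun x => ⟨x, Metric.mem_ball_self (by norm_num)⟩
    -- Orthonormal vectors have distance `√2`, so the balls of radius `1 / 2` are disjoint.
    have h0 : inner ℂ (x : H) (y : H) = 0 := hon.2 hxy
    have h1 : ‖(x : H) - y‖ ^ 2 = 2 := by
      rw [@norm_sub_sq ℂ, h0, hon.1 x, hon.1 y]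
      norm_num
    rw [dist_eq_norm]
    nlinarith [norm_nonneg ((x : H) - y)]
  have hdense := b.dense_span
  rw [hb, Subtype.range_coe] at hdense
  have hinf : Infinite s := by
    refine ⟨fun hfin => hH ?_⟩
    have hspan : FiniteDimensional ℂ (Submodule.span ℂ s) :=
      FiniteDimensional.span_of_finite ℂ hfin
    rw [(Submodule.closed_of_finiteDimensional _).submodule_topologicalClosure_eq] at hdense
    rw [hdense] at hspan
    exact Module.finite_def.2 (Module.Finite.iff_fg.1 hspan)
  obtain ⟨e⟩ : Nonempty (ℕ ≃ s) := by
    obtain ⟨_⟩ := nonempty_denumerable s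
    exact ⟨(Denumerable.eqv s).symm⟩
  refine ⟨fun n => e n, hon.comp e e.injective, ?_⟩
  have hrange : Set.range (fun n => (e n : H)) = s := by
    rw [show (fun n => (e n : H)) = (↑) ∘ e from rfl, e.surjective.range_comp, Subtype.range_coe]
  rw [hrange, Submodule.dense_iff_topologicalClosure_eq_top, hdense]

/-! ### Weyl systems -/

section Weyl

variable {E : Type*} [AddCommGroup E] [Module (ZMod 2) E]

/-- The alternating form `(x, y) ↦ β x y + β y x` attached to a bilinear form `β` over the
two-element field. -/
noncomputable def commForm (β : E →ₗ[ZMod 2] E →ₗ[ZMod 2] ZMod 2) :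
    E →ₗ[ZMod 2] E →ₗ[ZMod 2] ZMod 2 :=
  β + β.flip

theorem commForm_apply (β : E →ₗ[ZMod 2] E →ₗ[ZMod 2] ZMod 2) (x y : E) :
    commForm β x y = β x y + β y x := rfl

theorem commForm_symm (β : E →ₗ[ZMod 2] E →ₗ[ZMod 2] ZMod 2) (x y : E) :
    commForm β x y = commForm β y x := by
  rw [commForm_apply, commForm_apply, add_comm]

theorem commForm_self (β : E →ₗ[ZMod 2] E →ₗ[ZMod 2] ZMod 2) (x : E) : commForm β x x = 0 :=
  CharTwo.add_self_eq_zero _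

theorem add_self_eq_zero_of_zmod_two (x : E) : x + x = 0 := by
  rw [← two_smul (ZMod 2) x, show (2 : ZMod 2) = 0 from rfl, zero_smul]

variable {H : Type*} [NormedAddCommGroup H] [InnerProductSpace ℂ H] [CompleteSpace H]

/-- A projective representation by unitary operators of a vector space over the two-element field,
with the multiplier `(-1) ^ β x y` for a bilinear form `β`. -/
structure IsWeylSystem (β : E →ₗ[ZMod 2] E →ₗ[ZMod 2] ZMod 2) (A : E → H →L[ℂ] H) : Prop where
  mem_unitary : ∀ x, A x ∈ unitary (H →L[ℂ] H)
  mul : ∀ x y, A x * A y = sgn (β x y) • A (x + y)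

namespace IsWeylSystem

variable {β : E →ₗ[ZMod 2] E →ₗ[ZMod 2] ZMod 2} {A : E → H →L[ℂ] H}

theorem map_zero (hA : IsWeylSystem β A) : A 0 = 1 := by
  have h := hA.mul 0 0
  simp only [LinearMap.map_zero, sgn_zero, add_zero, one_smul] at h
  have h2 := Unitary.star_mul_self_of_mem (hA.mem_unitary 0)
  calc A 0 = (star (A 0) * A 0) * A 0 := by rw [h2, one_mul]
    _ = 1 := by rw [mul_assoc, h, h2]

theorem map_add (hA : IsWeylSystem β A) (x y : E) : A (x + y) = sgn (β x y) • (A x * A y) := by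
  rw [hA.mul, smul_smul, sgn_mul_self, one_smul]

theorem comm (hA : IsWeylSystem β A) (x y : E) :
    A x * A y = sgn (commForm β x y) • (A y * A x) := by
  rw [hA.mul, hA.mul, smul_smul, commForm_apply, sgn_add, mul_assoc, sgn_mul_self, mul_one,
    add_comm]

theorem mul_self (hA : IsWeylSystem β A) (x : E) : A x * A x = sgn (β x x) • 1 := by
  rw [hA.mul, add_self_eq_zero_of_zmod_two, hA.map_zero]

theorem star_eq (hA : IsWeylSystem β A) (x : E) : star (A x) = sgn (β x x) • A x := by
  have h := congrArg (star (A x) * ·) (hA.mul_self x)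
  simp only [← mul_assoc, Unitary.star_mul_self_of_mem (hA.mem_unitary x), one_mul,
    mul_smul_comm, mul_one] at h
  conv_rhs => rw [h]
  rw [smul_smul, sgn_mul_self, one_smul]

theorem inner_map_map (hA : IsWeylSystem β A) (x : E) (ξ η : H) :
    inner ℂ (A x ξ) (A x η) = inner ℂ ξ η := by
  rw [← ContinuousLinearMap.adjoint_inner_right, ← ContinuousLinearMap.star_eq_adjoint,
    ← mul_apply_eq_comp, Unitary.star_mul_self_of_mem (hA.mem_unitary x),
    one_apply_eq_self]

theorem map_ne_zero (hA : IsWeylSystem β A) (x : E) {ξ : H} (hξ : ξ ≠ 0) : A x ξ ≠ 0 := by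
  intro h
  have := hA.inner_map_map x ξ ξ
  rw [h, inner_zero_left] at this
  exact hξ (inner_self_eq_zero.1 this.symm)

theorem comm_apply (hA : IsWeylSystem β A) (x y : E) (ξ : H) :
    A x (A y ξ) = sgn (commForm β x y) • A y (A x ξ) := by
  have := congrArg (fun T : H →L[ℂ] H => T ξ) (hA.comm x y)
  simpa using this

theorem mul_apply (hA : IsWeylSystem β A) (x y : E) (ξ : H) :
    A x (A y ξ) = sgn (β x y) • A (x + y) ξ := by
  have := congrArg (fun T : H →L[ℂ] H => T ξ) (hA.mul x y)
  simpa using this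

theorem sgn_smul (hA : IsWeylSystem β A) (f : E →ₗ[ZMod 2] ZMod 2) :
    IsWeylSystem β fun x => sgn (f x) • A x where
  mem_unitary x := by
    have h := Unitary.mem_iff.1 (hA.mem_unitary x)
    rw [Unitary.mem_iff, star_smul, star_sgn]
    simp only [smul_mul_smul_comm, sgn_mul_self, one_smul]
    exact h
  mul x y := by
    rw [smul_mul_smul_comm, hA.mul, smul_smul, smul_smul, _root_.map_add, sgn_add, mul_comm]

theorem orthogonal_invariant (hA : IsWeylSystem β A) {x : E} {N : Submodule ℂ H}
    (hN : ∀ ξ ∈ N, A x ξ ∈ N) : ∀ ξ ∈ Nᗮ, A x ξ ∈ Nᗮ := by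
  intro ξ hξ
  rw [Submodule.mem_orthogonal] at hξ ⊢
  intro η hη
  rw [← ContinuousLinearMap.adjoint_inner_left, ← ContinuousLinearMap.star_eq_adjoint,
    hA.star_eq]
  exact hξ _ (N.smul_mem _ (hN η hη))

/-- In an irreducible Weyl system the operators `A x`, `x` in the radical of the commutation form,
are scalars: a root `μ` of the equation `μ ^ 2 = (A x) ^ 2` or its negative is an eigenvalue of
`A x`, and its eigenspace is invariant. -/
theorem exists_central_character (hA : IsWeylSystem β A)
    (hirr : ∀ M : Submodule ℂ H, IsClosed (M : Set H) → (∀ x, ∀ ξ ∈ M, A x ξ ∈ M) →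
      M = ⊥ ∨ M = ⊤) :
    ∃ z : E → ℂ, ∀ x, commForm β x = 0 → A x = z x • 1 := by
  suffices h : ∀ x, ∃ z : ℂ, commForm β x = 0 → A x = z • 1 from
    ⟨fun x => (h x).choose, fun x => (h x).choose_spec⟩
  intro x
  obtain ⟨μ, hμ⟩ := IsAlgClosed.exists_pow_nat_eq (sgn (β x x)) zero_lt_two
  by_cases hx : commForm β x = 0
  swap
  · exact ⟨0, fun h => absurd h hx⟩
  rcases hirr (LinearMap.ker ((A x - μ • 1 : H →L[ℂ] H) : H →ₗ[ℂ] H))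
    ((A x - μ • 1).isClosed_ker) (by
      intro y ξ hξ
      have hξ' : A x ξ = μ • ξ := by simpa [sub_eq_zero] using hξ
      have := hA.comm_apply x y ξ
      rw [hx, LinearMap.zero_apply, sgn_zero, one_smul, hξ'] at this
      simp [this]) with h | h
  · refine ⟨-μ, fun _ => ?_⟩
    ext ξ
    have hmem : A x ξ + μ • ξ ∈ LinearMap.ker ((A x - μ • 1 : H →L[ℂ] H) : H →ₗ[ℂ] H) := by
      have h2 := hA.mul_apply x x ξ
      rw [add_self_eq_zero_of_zmod_two, hA.map_zero, ← hμ] at h2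
      simp only [LinearMap.mem_ker, ContinuousLinearMap.coe_coe, _root_.map_add, _root_.map_smul,
        sub_apply, smul_apply, one_apply_eq_self, h2, pow_two, mul_smul,
        smul_sub]
      abel
    rw [h, Submodule.mem_bot] at hmem
    simpa using eq_neg_of_add_eq_zero_left hmem
  · refine ⟨μ, fun _ => ?_⟩
    ext ξ
    have hmem : ξ ∈ LinearMap.ker ((A x - μ • 1 : H →L[ℂ] H) : H →ₗ[ℂ] H) := by
      rw [h]
      trivial
    simpa [sub_eq_zero] using hmem

theorem separableSpace (hA : IsWeylSystem β A) [Countable E]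
    (hirr : ∀ M : Submodule ℂ H, IsClosed (M : Set H) → (∀ x, ∀ ξ ∈ M, A x ξ ∈ M) →
      M = ⊥ ∨ M = ⊤) : TopologicalSpace.SeparableSpace H := by
  rcases subsingleton_or_nontrivial H with hH | hH
  · exact inferInstance
  obtain ⟨ξ, hξ⟩ := exists_ne (0 : H)
  let N := Submodule.span ℂ (Set.range fun x => A x ξ)
  have hN : ∀ x, ∀ η ∈ N, A x η ∈ N := by
    intro x η hη
    induction hη using Submodule.span_induction with
    | mem η h =>
      obtain ⟨y, rfl⟩ := h
      rw [hA.mul_apply]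
      exact N.smul_mem _ (Submodule.subset_span ⟨x + y, rfl⟩)
    | zero => simp
    | add η η' _ _ h h' => rw [_root_.map_add]; exact N.add_mem h h'
    | smul a η _ h => rw [_root_.map_smul]; exact N.smul_mem _ h
  have htop : N.topologicalClosure = ⊤ := by
    refine (hirr _ N.isClosed_topologicalClosure fun x η hη => ?_).resolve_left fun h => ?_
    · exact (A x).continuous.closure_preimage_subset _ (closure_mono (hN x) hη)
    · have hmem : ξ ∈ N.topologicalClosure :=
        N.le_topologicalClosure (Submodule.subset_span ⟨0, by simp [hA.map_zero]⟩)
      rw [h, Submodule.mem_bot] at hmem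
      exact hξ hmem
  have hsep : TopologicalSpace.IsSeparable (N.topologicalClosure : Set H) :=
    ((Set.countable_range _).isSeparable.span (R := ℂ)).closure
  rw [htop] at hsep
  exact TopologicalSpace.isSeparable_univ_iff.1 hsep

/-- If the commutation form has infinite rank, then the operators of a Weyl system span an
infinite-dimensional space, since the trace makes them pairwise orthogonal modulo the radical. -/
theorem not_finiteDimensional [Nontrivial H] (hA : IsWeylSystem β A)
    (hβ : Infinite (E ⧸ LinearMap.ker (commForm β))) : ¬ FiniteDimensional ℂ H := by
  intro hH
  let B : E → Module.End ℂ H := fun x => (A x : H →ₗ[ℂ] H)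
  have hmul : ∀ x y, B x * B y = sgn (β x y) • B (x + y) := fun x y =>
    LinearMap.ext fun ξ => hA.mul_apply x y ξ
  have hcomm : ∀ x y, B x * B y = sgn (commForm β x y) • (B y * B x) := fun x y =>
    LinearMap.ext fun ξ => hA.comm_apply x y ξ
  have hB0 : B 0 = 1 := LinearMap.ext fun ξ => by simp [B, hA.map_zero]
  -- `B x` anticommutes with some invertible `B y`, and hence is conjugate to `-B x`.
  have htr : ∀ x, commForm β x ≠ 0 → LinearMap.trace ℂ H (B x) = 0 := by
    intro x hx
    obtain ⟨y, hy⟩ : ∃ y, commForm β x y ≠ 0 := by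
      by_contra! hcon
      exact hx (LinearMap.ext hcon)
    have hy1 := (zmod_two_cases _).resolve_left hy
    have h1 : LinearMap.trace ℂ H (B x * B y * B y) = - LinearMap.trace ℂ H (B x * B y * B y) := by
      conv_lhs => rw [hcomm x y, hy1, sgn_one, neg_one_smul, neg_mul, _root_.map_neg, mul_assoc,
        LinearMap.trace_mul_comm]
    have h2 : LinearMap.trace ℂ H (B x * B y * B y) = 0 := by
      linear_combination h1 / 2
    rw [mul_assoc, hmul y y, add_self_eq_zero_of_zmod_two, hB0, mul_smul_comm, mul_one,
      _root_.map_smul, smul_eq_mul] at h2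
    exact (mul_eq_zero.1 h2).resolve_left (sgn_ne_zero _)
  have hlin : LinearIndependent ℂ
      (fun q : E ⧸ LinearMap.ker (commForm β) => B (Quotient.out q)) := by
    rw [linearIndependent_iff']
    intro s g hg q hq
    have h1 := congrArg (fun T => LinearMap.trace ℂ H (T * B (Quotient.out q))) hg
    simp only [Finset.sum_mul, smul_mul_assoc, _root_.map_sum, _root_.map_smul, zero_mul,
      _root_.map_zero] at h1
    rw [Finset.sum_eq_single q] at h1
    · rw [hmul, add_self_eq_zero_of_zmod_two, hB0, _root_.map_smul, LinearMap.trace_one,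
        smul_eq_mul, smul_eq_mul] at h1
      refine (mul_eq_zero.1 h1).resolve_right (mul_ne_zero (sgn_ne_zero _) ?_)
      exact_mod_cast (Module.finrank_pos (R := ℂ) (M := H)).ne'
    · intro p _ hpq
      rw [hmul, _root_.map_smul, htr, smul_zero, smul_zero]
      intro h0
      refine hpq ?_
      rw [← Quotient.out_eq' p, ← Quotient.out_eq' q]
      refine (Submodule.Quotient.eq _).2 ?_
      have : Quotient.out p - Quotient.out q = Quotient.out p + Quotient.out q := by
        rw [sub_eq_add_neg, neg_eq_of_add_eq_zero_left (add_self_eq_zero_of_zmod_two _)]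
      rw [this]
      exact h0
    · exact fun h => absurd hq h
  exact not_finite_iff_infinite.2 hβ hlin.finite

/-- Finitely many commuting operators of a Weyl system have a joint eigenvector in every nonzero
subspace that they leave invariant. -/
theorem exists_joint_eigenvector (hA : IsWeylSystem β A) (s : Finset E)
    (hs : ∀ x ∈ s, ∀ y ∈ s, commForm β x y = 0) {N : Submodule ℂ H} (hN : N ≠ ⊥)
    (hinv : ∀ x ∈ s, ∀ ξ ∈ N, A x ξ ∈ N) :
    ∃ χ : E → ℂ, ∃ ξ ∈ N, ξ ≠ 0 ∧ ∀ x ∈ s, A x ξ = χ x • ξ := by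
  classical
  induction s using Finset.induction_on with
  | empty =>
    obtain ⟨ξ, hξ, h0⟩ := N.ne_bot_iff.1 hN
    exact ⟨0, ξ, hξ, h0, by simp⟩
  | insert x s hx ih =>
    obtain ⟨χ, ξ, hξ, h0, h⟩ := ih
      (fun a ha b hb => hs a (Finset.mem_insert_of_mem ha) b (Finset.mem_insert_of_mem hb))
      (fun a ha => hinv a (Finset.mem_insert_of_mem ha))
    obtain ⟨μ, hμ⟩ := IsAlgClosed.exists_pow_nat_eq (sgn (β x x)) zero_lt_two
    have hupd : ∀ a : ℂ, ∀ y ∈ s, Function.update χ x a y = χ y := fun a y hy =>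
      Function.update_of_ne (fun h => hx (by rwa [← h])) _ _
    -- `(A x - μ) (A x + μ) = 0`, so `(A x + μ) ξ` is an eigenvector for `μ` unless it vanishes.
    by_cases hη : A x ξ + μ • ξ = 0
    · refine ⟨Function.update χ x (-μ), ξ, hξ, h0, fun y hy => ?_⟩
      rcases Finset.mem_insert.1 hy with rfl | hy
      · simpa using eq_neg_of_add_eq_zero_left hη
      · rw [hupd _ y hy, h y hy]
    · refine ⟨Function.update χ x μ, A x ξ + μ • ξ,
        N.add_mem (hinv x (Finset.mem_insert_self x s) ξ hξ) (N.smul_mem _ hξ), hη,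
        fun y hy => ?_⟩
      rcases Finset.mem_insert.1 hy with rfl | hy
      · have h2 := hA.mul_apply y y ξ
        rw [add_self_eq_zero_of_zmod_two, hA.map_zero, ← hμ] at h2
        simp only [_root_.map_add, _root_.map_smul, h2, Function.update_self, smul_add,
          one_apply_eq_self, pow_two, mul_smul]
        rw [add_comm]
      · rw [hupd _ y hy, _root_.map_add, _root_.map_smul, hA.comm_apply y x,
          hs y (Finset.mem_insert_of_mem hy) x (Finset.mem_insert_self x s), sgn_zero, one_smul,
          h y hy, _root_.map_smul, smul_add, smul_comm]

end IsWeylSystem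

end Weyl

/-! ### Eigenspaces of maximal isotropic subspaces -/

section Weyl

variable {E : Type*} [AddCommGroup E] [Module (ZMod 2) E]
  {β : E →ₗ[ZMod 2] E →ₗ[ZMod 2] ZMod 2}
  {H : Type*} [NormedAddCommGroup H] [InnerProductSpace ℂ H]

/-- The joint eigenspace of the operators `A l`, `l ∈ L`, for the eigenvalues `χ l`. -/
def jointEigenspace (A : E → H →L[ℂ] H) (L : Submodule (ZMod 2) E) (χ : E → ℂ) :
    Submodule ℂ H where
  carrier := {ξ | ∀ l ∈ L, A l ξ = χ l • ξ}
  add_mem' := fun {ξ η} hξ hη l hl => by rw [map_add, hξ l hl, hη l hl, smul_add]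
  zero_mem' := fun l _ => by simp
  smul_mem' := fun a ξ hξ l hl => by rw [map_smul, hξ l hl, smul_comm]

theorem mem_jointEigenspace {A : E → H →L[ℂ] H} {L : Submodule (ZMod 2) E} {χ : E → ℂ} {ξ : H} :
    ξ ∈ jointEigenspace A L χ ↔ ∀ l ∈ L, A l ξ = χ l • ξ := Iff.rfl

theorem isClosed_jointEigenspace (A : E → H →L[ℂ] H) (L : Submodule (ZMod 2) E) (χ : E → ℂ) :
    IsClosed (jointEigenspace A L χ : Set H) := by
  have : (jointEigenspace A L χ : Set H) = ⋂ l ∈ L, {ξ | A l ξ = χ l • ξ} := by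
    ext ξ
    simp [mem_jointEigenspace]
  rw [this]
  exact isClosed_biInter fun l _ =>
    isClosed_eq (A l).continuous (continuous_const_smul (χ l))

/-- The possible systems of eigenvalues on an isotropic subspace `L` of a Weyl system with
central character `z`. -/
structure IsTwistedCharacter (β : E →ₗ[ZMod 2] E →ₗ[ZMod 2] ZMod 2) (L : Submodule (ZMod 2) E)
    (z χ : E → ℂ) : Prop where
  ne_zero : ∀ l ∈ L, χ l ≠ 0
  mul : ∀ l ∈ L, ∀ l' ∈ L, χ l * χ l' = sgn (β l l') * χ (l + l')
  eq_of_radical : ∀ l ∈ L, commForm β l = 0 → χ l = z l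

theorem IsTwistedCharacter.sq {L : Submodule (ZMod 2) E} {z χ : E → ℂ}
    (h : IsTwistedCharacter β L z χ) {l : E} (hl : l ∈ L) : χ l ^ 2 = sgn (β l l) := by
  have h0 := h.mul 0 L.zero_mem 0 L.zero_mem
  rw [map_zero, sgn_zero, one_mul, add_zero] at h0
  have h1 : χ 0 = 1 := by simpa [h.ne_zero 0 L.zero_mem] using h0
  rw [pow_two, h.mul l hl l hl, add_self_eq_zero_of_zmod_two, h1, mul_one]

namespace IsWeylSystem

variable [CompleteSpace H]
  {K : Type*} [NormedAddCommGroup K] [InnerProductSpace ℂ K] [CompleteSpace K]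
  {A : E → H →L[ℂ] H} {F L : Submodule (ZMod 2) E} {z χ : E → ℂ}

theorem isTwistedCharacter_of_eigenvector (hA : IsWeylSystem β A)
    (hz : ∀ x, commForm β x = 0 → A x = z x • 1) {ξ : H} (hξ : ξ ≠ 0)
    (h : ξ ∈ jointEigenspace A L χ) : IsTwistedCharacter β L z χ where
  ne_zero l hl h0 := hA.map_ne_zero l hξ (by rw [h l hl, h0, zero_smul])
  mul l hl l' hl' := by
    have h1 := hA.mul_apply l l' ξ
    rw [h l' hl', map_smul, h l hl, h _ (L.add_mem hl hl'), smul_smul, smul_smul, mul_comm] at h1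
    exact smul_left_injective ℂ hξ h1
  eq_of_radical l hl h0 := by
    have h1 := h l hl
    rw [hz l h0] at h1
    exact (smul_left_injective ℂ hξ (by simpa using h1)).symm

theorem exists_twistedCharacter [Nontrivial H] (hA : IsWeylSystem β A)
    (hz : ∀ x, commForm β x = 0 → A x = z x • 1) (hL : (L : Set E).Finite)
    (hiso : ∀ x ∈ L, ∀ y ∈ L, commForm β x y = 0) : ∃ χ, IsTwistedCharacter β L z χ := by
  obtain ⟨χ, ξ, -, hξ, h⟩ := hA.exists_joint_eigenvector hL.toFinset
    (by simpa using hiso) (N := ⊤) top_ne_bot (fun _ _ _ _ => trivial)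
  exact ⟨χ, hA.isTwistedCharacter_of_eigenvector hz hξ fun l hl => h l (by simpa using hl)⟩

/-- The operators `A y`, `y ∈ F`, permute the joint eigenspaces of `L` transitively, so that each of
them meets every subspace that is invariant under these operators. -/
theorem exists_mem_jointEigenspace (hA : IsWeylSystem β A)
    (hz : ∀ x, commForm β x = 0 → A x = z x • 1) (hF : (F : Set E).Finite)
    (hrad : ∀ x ∈ F, (∀ y ∈ F, commForm β x y = 0) → commForm β x = 0) (hLF : L ≤ F)
    (hiso : ∀ x ∈ L, ∀ y ∈ L, commForm β x y = 0) (hχ : IsTwistedCharacter β L z χ)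
    {N : Submodule ℂ H} (hN : N ≠ ⊥) (hinv : ∀ x ∈ F, ∀ ξ ∈ N, A x ξ ∈ N) :
    ∃ ξ ∈ N, ξ ≠ 0 ∧ ξ ∈ jointEigenspace A L χ := by
  obtain ⟨χ', ξ, hξN, hξ, h⟩ := hA.exists_joint_eigenvector (hF.subset hLF).toFinset
    (by simpa using hiso) hN (fun x hx => hinv x (hLF (by simpa using hx)))
  have hξ' : ξ ∈ jointEigenspace A L χ' := fun l hl => h l (by simpa using hl)
  have hχ' := hA.isTwistedCharacter_of_eigenvector hz hξ hξ'
  -- `χ` and `χ'` differ by a functional on `L`, which is `ω(·, y)` for some `y ∈ F`; then `A y`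
  -- carries the eigenvector for `χ'` to one for `χ`.
  have hf : ∀ l : L, ∃ e : ZMod 2, χ l = sgn e * χ' l := fun l =>
    exists_eq_sgn_mul (by rw [hχ.sq l.2, hχ'.sq l.2])
  choose f hf using hf
  have hadd : ∀ l l' : L, f (l + l') = f l + f l' := fun l l' => by
    have h1 := hχ.mul l l.2 l' l'.2
    have h2 := hf (l + l')
    rw [Submodule.coe_add] at h2
    rw [h2, hf l, hf l', mul_mul_mul_comm, hχ'.mul l l.2 l' l'.2] at h1
    have h3 := hχ'.ne_zero _ (l + l').2
    have h4 := sgn_ne_zero (β l l')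
    apply sgn_injective
    rw [sgn_add]
    apply mul_right_cancel₀ (mul_ne_zero h4 h3)
    rw [Submodule.coe_add]
    linear_combination -h1
  let f' : L →ₗ[ZMod 2] ZMod 2 := (AddMonoidHom.mk' f hadd).toZModLinearMap 2
  have hf' : ∀ l, f' l = f l := fun l => rfl
  obtain ⟨y, hy, hfy⟩ := exists_eq_form_of_vanish (commForm β) hF hrad hLF f' fun l hl => by
    have h1 := hf l
    rw [hχ.eq_of_radical l l.2 hl, ← hχ'.eq_of_radical l l.2 hl] at h1
    rw [hf', ← sgn_eq_one_iff]
    exact mul_right_cancel₀ (hχ'.ne_zero l l.2) (by rw [← h1, one_mul])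
  refine ⟨A y ξ, hinv y hy ξ hξN, hA.map_ne_zero y hξ, fun l hl => ?_⟩
  rw [hA.comm_apply, hξ' l hl, map_smul, smul_smul, ← hfy ⟨l, hl⟩, hf', ← hf]

open Classical in
/-- The inner products of the vectors `A x ξ`, `x ∈ F`, `ξ` in a joint eigenspace of a maximal
isotropic subspace `L` of `F`, are determined by the eigenvalues: if `w ∈ F` is not in `L`, then
`A w` anticommutes with some `A l`, `l ∈ L`, and hence carries the eigenspace to an orthogonal
one. -/
theorem inner_map_eigenvectors (hA : IsWeylSystem β A)
    (hmax : ∀ x ∈ F, (∀ l ∈ L, commForm β x l = 0) → x ∈ L)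
    {ξ η : H} (hξ : ξ ∈ jointEigenspace A L χ) (hη : η ∈ jointEigenspace A L χ) {x y : E}
    (hx : x ∈ F) (hy : y ∈ F) :
    inner ℂ (A x ξ) (A y η) =
      if x + y ∈ L then sgn (β x x) * sgn (β x y) * χ (x + y) * inner ℂ ξ η else 0 := by
  have h1 : inner ℂ (A x ξ) (A y η) =
      sgn (β x x) * sgn (β x y) * inner ℂ ξ (A (x + y) η) := by
    rw [← ContinuousLinearMap.adjoint_inner_right, ← ContinuousLinearMap.star_eq_adjoint,
      hA.star_eq, smul_apply, hA.mul_apply, inner_smul_right, inner_smul_right, mul_assoc]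
  rw [h1]
  split_ifs with hL
  · rw [hη _ hL, inner_smul_right]
    ring
  · obtain ⟨l, hl, hne⟩ : ∃ l ∈ L, commForm β (x + y) l ≠ 0 := by
      by_contra! hcon
      exact hL (hmax _ (F.add_mem hx hy) hcon)
    have hone := (zmod_two_cases _).resolve_left hne
    have h2 := hA.inner_map_map l ξ (A (x + y) η)
    rw [hA.comm_apply, commForm_symm, hone, sgn_one, hη l hl, hξ l hl, map_smul, inner_smul_right,
      inner_smul_right, inner_smul_left] at h2
    have h3 : (1 + Complex.normSq (χ l) : ℂ) * inner ℂ ξ (A (x + y) η) = 0 := by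
      rw [Complex.normSq_eq_conj_mul_self]
      linear_combination -h2
    have h4 : (1 + Complex.normSq (χ l) : ℂ) ≠ 0 := by
      have := Complex.normSq_nonneg (χ l)
      exact_mod_cast (by linarith : (1 + Complex.normSq (χ l)) ≠ 0)
    rw [(mul_eq_zero.1 h3).resolve_left h4, mul_zero]

/-- The translates under `F` of a total family of a joint eigenspace of `L` are total. -/
theorem dense_span_translates (hA : IsWeylSystem β A)
    (hz : ∀ x, commForm β x = 0 → A x = z x • 1) (hF : (F : Set E).Finite)
    (hrad : ∀ x ∈ F, (∀ y ∈ F, commForm β x y = 0) → commForm β x = 0) (hLF : L ≤ F)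
    (hiso : ∀ x ∈ L, ∀ y ∈ L, commForm β x y = 0) (hχ : IsTwistedCharacter β L z χ)
    {ι : Type*} {a : ι → jointEigenspace A L χ}
    (ha : Dense (Submodule.span ℂ (Set.range a) : Set (jointEigenspace A L χ))) :
    Dense (Submodule.span ℂ (Set.range fun p : F × ι => A p.1 (a p.2)) : Set H) := by
  set N := Submodule.span ℂ (Set.range fun p : F × ι => A p.1 (a p.2)) with hNdef
  rw [Submodule.dense_iff_topologicalClosure_eq_top, Submodule.topologicalClosure_eq_top_iff]
  by_contra hne
  have hN : ∀ x ∈ F, ∀ η ∈ N, A x η ∈ N := by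
    intro x hx η hη
    induction hη using Submodule.span_induction with
    | mem η h =>
      obtain ⟨p, rfl⟩ := h
      rw [hA.mul_apply]
      exact N.smul_mem _ (Submodule.subset_span ⟨(⟨x + p.1, F.add_mem hx p.1.2⟩, p.2), rfl⟩)
    | zero => simp
    | add η η' _ _ h h' => rw [_root_.map_add]; exact N.add_mem h h'
    | smul a η _ h => rw [_root_.map_smul]; exact N.smul_mem _ h
  obtain ⟨ξ, hξN, hξ, hξχ⟩ := hA.exists_mem_jointEigenspace hz hF hrad hLF hiso hχ hne
    fun x hx => hA.orthogonal_invariant (hN x hx)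
  have hle : Submodule.span ℂ (Set.range a) ≤
      (LinearMap.ker (innerSL ℂ ξ : H →ₗ[ℂ] ℂ)).comap (jointEigenspace A L χ).subtype := by
    rw [Submodule.span_le]
    rintro _ ⟨i, rfl⟩
    have hmem : (a i : H) ∈ N := Submodule.subset_span ⟨(0, i), by simp [hA.map_zero]⟩
    simpa using (Submodule.mem_orthogonal' N ξ).1 hξN _ hmem
  have hclosed : IsClosed {η : jointEigenspace A L χ | inner ℂ ξ (η : H) = 0} :=
    isClosed_eq (by fun_prop) continuous_const
  have h0 := hclosed.closure_subset_iff.2 (fun η hη => by simpa using hle hη) (ha ⟨ξ, hξχ⟩)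
  exact hξ (inner_self_eq_zero.1 h0)

theorem jointEigenspace_not_finiteDimensional (hA : IsWeylSystem β A)
    (hz : ∀ x, commForm β x = 0 → A x = z x • 1) (hF : (F : Set E).Finite)
    (hrad : ∀ x ∈ F, (∀ y ∈ F, commForm β x y = 0) → commForm β x = 0) (hLF : L ≤ F)
    (hiso : ∀ x ∈ L, ∀ y ∈ L, commForm β x y = 0) (hχ : IsTwistedCharacter β L z χ)
    (hH : ¬ FiniteDimensional ℂ H) : ¬ FiniteDimensional ℂ (jointEigenspace A L χ) := by
  intro hfin
  have : Finite F := hF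
  have hdense := hA.dense_span_translates hz hF hrad hLF hiso hχ
    (a := Module.finBasis ℂ (jointEigenspace A L χ)) (by
      rw [Module.Basis.span_eq]
      exact dense_univ)
  have hspan : FiniteDimensional ℂ (Submodule.span ℂ (Set.range
      fun p : F × Fin (Module.finrank ℂ (jointEigenspace A L χ)) =>
        A p.1 (Module.finBasis ℂ (jointEigenspace A L χ) p.2))) :=
    FiniteDimensional.span_of_finite ℂ (Set.finite_range _)
  rw [Submodule.dense_iff_topologicalClosure_eq_top,
    (Submodule.closed_of_finiteDimensional _).submodule_topologicalClosure_eq] at hdense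
  rw [hdense] at hspan
  exact hH (Module.finite_def.2 (Module.Finite.iff_fg.1 hspan))

/-- Two irreducible Weyl systems of infinite rank with the same central character are unitarily
equivalent on every finite subspace. -/
theorem exists_intertwiner [Countable E] [Nontrivial H] [Nontrivial K] {B : E → K →L[ℂ] K}
    (hA : IsWeylSystem β A) (hB : IsWeylSystem β B)
    (hβ : Infinite (E ⧸ LinearMap.ker (commForm β)))
    (hirrA : ∀ M : Submodule ℂ H, IsClosed (M : Set H) → (∀ x, ∀ ξ ∈ M, A x ξ ∈ M) →
      M = ⊥ ∨ M = ⊤)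
    (hirrB : ∀ M : Submodule ℂ K, IsClosed (M : Set K) → (∀ x, ∀ ξ ∈ M, B x ξ ∈ M) →
      M = ⊥ ∨ M = ⊤)
    (hzA : ∀ x, commForm β x = 0 → A x = z x • 1) (hzB : ∀ x, commForm β x = 0 → B x = z x • 1)
    {F₀ : Submodule (ZMod 2) E} (hF₀ : (F₀ : Set E).Finite) :
    ∃ W : H ≃ₗᵢ[ℂ] K, ∀ x ∈ F₀, ∀ ξ, W (A x ξ) = B x (W ξ) := by
  obtain ⟨F, hle, hF, hrad⟩ := exists_finite_radical_le (commForm β) (commForm_symm β) F₀ hF₀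
  obtain ⟨L, hLF, hiso, hmax⟩ :=
    exists_maximal_isotropic (commForm β) (commForm_symm β) (commForm_self β) F
  obtain ⟨χ, hχ⟩ := hA.exists_twistedCharacter hzA (hF.subset hLF) hiso
  have := hA.separableSpace hirrA
  have := hB.separableSpace hirrB
  have : SecondCountableTopology H := UniformSpace.secondCountable_of_separable H
  have : SecondCountableTopology K := UniformSpace.secondCountable_of_separable K
  have : CompleteSpace (jointEigenspace A L χ) :=
    (isClosed_jointEigenspace A L χ).completeSpace_coe
  have : CompleteSpace (jointEigenspace B L χ) :=
    (isClosed_jointEigenspace B L χ).completeSpace_coe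
  obtain ⟨a, ha, hda⟩ := exists_hilbertBasis_nat (hA.jointEigenspace_not_finiteDimensional hzA hF
    hrad hLF hiso hχ (hA.not_finiteDimensional hβ))
  obtain ⟨b, hb, hdb⟩ := exists_hilbertBasis_nat (hB.jointEigenspace_not_finiteDimensional hzB hF
    hrad hLF hiso hχ (hB.not_finiteDimensional hβ))
  have hda' := hA.dense_span_translates hzA hF hrad hLF hiso hχ hda
  obtain ⟨W, hW⟩ := exists_isometryEquiv_of_inner_eq hda'
    (hB.dense_span_translates hzB hF hrad hLF hiso hχ hdb) (fun p q => by
      rw [hA.inner_map_eigenvectors hmax (a p.2).2 (a q.2).2 p.1.2 q.1.2,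
        hB.inner_map_eigenvectors hmax (b p.2).2 (b q.2).2 p.1.2 q.1.2,
        ← Submodule.coe_inner, ← Submodule.coe_inner, orthonormal_iff_ite.1 ha,
        orthonormal_iff_ite.1 hb])
  refine ⟨W, fun x hx ξ => ?_⟩
  have hclosed : IsClosed {ξ | W (A x ξ) = B x (W ξ)} := isClosed_eq (by fun_prop) (by fun_prop)
  refine hclosed.closure_subset_iff.2 (fun ξ hξ => ?_) (hda' ξ)
  induction hξ using Submodule.span_induction with
  | mem ξ h =>
    obtain ⟨p, rfl⟩ := h
    have h1 := hW (⟨x + p.1, F.add_mem (hle hx) p.1.2⟩, p.2)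
    have h2 := hW p
    simp only [Set.mem_ofPred_eq] at h1 h2 ⊢
    rw [h2, hA.mul_apply, hB.mul_apply, map_smul, h1]
  | zero => simp
  | add η η' _ _ h h' =>
    simp only [Set.mem_ofPred_eq, _root_.map_add] at h h' ⊢
    rw [h, h']
  | smul a η _ h =>
    simp only [Set.mem_ofPred_eq, _root_.map_smul] at h ⊢
    rw [h]

end IsWeylSystem

end Weyl

/-! ### The Weyl system of a spin system -/

/-- The strictly lower triangular part `∑ j < i, c i j * x i * y j` of the form `ω`. -/
noncomputable def orderForm (c : Matrix ℕ ℕ (ZMod 2)) : Gam →ₗ[ZMod 2] Gam →ₗ[ZMod 2] ZMod 2 :=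
  Finsupp.linearCombination (ZMod 2) fun i =>
    Finsupp.linearCombination (ZMod 2) fun j => if j < i then c i j else 0

theorem orderForm_single_left (c : Matrix ℕ ℕ (ZMod 2)) (k : ℕ) (x : Gam) :
    orderForm c (Finsupp.single k 1) x = ∑ j ∈ Finset.range k, c k j * x j := by
  rw [orderForm, Finsupp.linearCombination_single, one_smul, Finsupp.linearCombination_apply]
  simp only [Finsupp.sum, smul_eq_mul, mul_ite, mul_zero]
  rw [← Finset.sum_filter]
  refine Finset.sum_subset_zero_on_sdiff (fun j hj => ?_) (fun j hj => ?_)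
    (fun j _ => mul_comm _ _)
  · simpa using (Finset.mem_filter.1 hj).2
  · simp only [Finset.mem_sdiff, Finset.mem_range, Finset.mem_filter, Finsupp.mem_support_iff,
      not_and, not_imp_not] at hj
    rw [hj.2 hj.1, mul_zero]

theorem commForm_orderForm {c : Matrix ℕ ℕ (ZMod 2)} (hsymm : ∀ i j, c i j = c j i)
    (hdiag : ∀ i, c i i = 0) : commForm (orderForm c) = omega c := by
  refine Finsupp.lhom_ext' fun i => LinearMap.ext_ring (Finsupp.lhom_ext' fun j =>
    LinearMap.ext_ring ?_)
  simp only [LinearMap.comp_apply, Finsupp.lsingle_apply, commForm_apply, orderForm, omega,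
    Finsupp.linearCombination_single, one_smul]
  rcases lt_trichotomy i j with h | rfl | h
  · simp [h, h.not_gt]
  · simp [hdiag]
  · simp [h, h.not_gt, hsymm i j]

section Product

variable {H : Type*} [NormedAddCommGroup H] [InnerProductSpace ℂ H] [CompleteSpace H]
  {c : Matrix ℕ ℕ (ZMod 2)} {U : ℕ → H →L[ℂ] H}

/-- The ordered product of the operators `U i ^ x i`, `i < n`. -/
noncomputable def orderedProd (U : ℕ → H →L[ℂ] H) (x : Gam) : ℕ → H →L[ℂ] H
  | 0 => 1
  | n + 1 => orderedProd U x n * U n ^ (x n).val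

omit [CompleteSpace H] in
theorem orderedProd_congr {x y : Gam} {n : ℕ} (h : ∀ j < n, x j = y j) :
    orderedProd U x n = orderedProd U y n := by
  induction n with
  | zero => rfl
  | succ n ih =>
    rw [orderedProd, orderedProd, ih fun j hj => h j (hj.trans n.lt_succ_self),
      h n n.lt_succ_self]

omit [CompleteSpace H] in
theorem orderedProd_eq_of_le {x : Gam} {m n : ℕ} (hmn : m ≤ n) (h : ∀ j, m ≤ j → x j = 0) :
    orderedProd U x n = orderedProd U x m := by
  induction n, hmn using Nat.le_induction with
  | base => rfl
  | succ n hn ih => rw [orderedProd, ih, h n hn, ZMod.val_zero, pow_zero, mul_one]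

namespace IsSpinSystem

theorem mul_self (hU : IsSpinSystem c U) (k : ℕ) : U k * U k = 1 := by
  have h := Unitary.star_mul_self_of_mem (hU.mem_unitary k)
  rwa [(hU.isSelfAdjoint k).star_eq] at h

theorem mul_pow (hU : IsSpinSystem c U) (k n : ℕ) (a : ZMod 2) :
    U k * U n ^ a.val = sgn (c k n * a) • (U n ^ a.val * U k) := by
  rcases zmod_two_cases a with rfl | rfl
  · simp [sgn_zero]
  · simpa [ZMod.val_one] using hU.comm k n

theorem mul_orderedProd_comm (hU : IsSpinSystem c U) (k n : ℕ) (x : Gam) :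
    U k * orderedProd U x n =
      sgn (∑ j ∈ Finset.range n, c k j * x j) • (orderedProd U x n * U k) := by
  induction n with
  | zero => simp [orderedProd, sgn_zero]
  | succ n ih =>
    rw [orderedProd, ← mul_assoc, ih, Finset.sum_range_succ, sgn_add, smul_mul_assoc, mul_assoc,
      hU.mul_pow, mul_smul_comm, smul_smul, mul_assoc]

theorem mul_orderedProd (hU : IsSpinSystem c U) {k n : ℕ} (hk : k < n) (x : Gam) :
    U k * orderedProd U x n =
      sgn (∑ j ∈ Finset.range k, c k j * x j) • orderedProd U (x + Finsupp.single k 1) n := by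
  induction n with
  | zero => exact absurd hk k.not_lt_zero
  | succ n ih =>
    rcases (Nat.lt_succ_iff_lt_or_eq.1 hk) with hk | rfl
    · rw [orderedProd, ← mul_assoc, ih hk, orderedProd, smul_mul_assoc, Finsupp.add_apply,
        Finsupp.single_eq_of_ne hk.ne', add_zero]
    · have hpow : U k * U k ^ (x k).val = U k ^ ((x + Finsupp.single k 1 : Gam) k).val := by
        rw [Finsupp.add_apply, Finsupp.single_eq_same]
        rcases zmod_two_cases (x k) with h | h
        · simp [h, ZMod.val_one]
        · simp [h, ZMod.val_one, hU.mul_self, CharTwo.add_self_eq_zero]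
      rw [orderedProd, ← mul_assoc, hU.mul_orderedProd_comm, orderedProd, smul_mul_assoc,
        mul_assoc, hpow, orderedProd_congr (y := x + Finsupp.single k 1)]
      intro j hj
      rw [Finsupp.add_apply, Finsupp.single_eq_of_ne hj.ne, add_zero]

theorem orderedProd_mem_unitary (hU : IsSpinSystem c U) (x : Gam) (n : ℕ) :
    orderedProd U x n ∈ unitary (H →L[ℂ] H) := by
  induction n with
  | zero => exact one_mem _
  | succ n ih => exact mul_mem ih (pow_mem (hU.mem_unitary n) _)

/-- The operators of a spin system generate a Weyl system: ordered products of the `U k`. -/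
theorem exists_isWeylSystem (hU : IsSpinSystem c U) :
    ∃ A : Gam → H →L[ℂ] H, IsWeylSystem (orderForm c) A ∧ ∀ k, A (Finsupp.single k 1) = U k := by
  let A : Gam → H →L[ℂ] H := fun x => orderedProd U x (x.support.sup id + 1)
  have hA : ∀ (x : Gam) n, x.support.sup id + 1 ≤ n → orderedProd U x n = A x := by
    refine fun x n hn => orderedProd_eq_of_le hn fun j hj => ?_
    by_contra h
    have := Finset.le_sup (f := id) (Finsupp.mem_support_iff.2 h)
    simp only [id_eq] at this
    omega
  have hA0 : A 0 = 1 := by simp [A, orderedProd]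
  have hstep : ∀ k x, U k * A x = sgn (orderForm c (Finsupp.single k 1) x) •
      A (x + Finsupp.single k 1) := by
    intro k x
    obtain ⟨n, h1, h2, h3⟩ : ∃ n, x.support.sup id + 1 ≤ n ∧
        (x + Finsupp.single k 1).support.sup id + 1 ≤ n ∧ k < n :=
      ⟨max (x.support.sup id + 1) (max ((x + Finsupp.single k 1).support.sup id + 1) (k + 1)),
        by omega, by omega, by omega⟩
    rw [← hA x n h1, ← hA _ n h2, hU.mul_orderedProd h3, orderForm_single_left]
  have hsingle : ∀ k, A (Finsupp.single k 1) = U k := fun k => by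
    have := hstep k 0
    rw [hA0, mul_one, map_zero, sgn_zero, one_smul, zero_add] at this
    exact this.symm
  refine ⟨A, ⟨fun x => hU.orderedProd_mem_unitary x _, fun x => ?_⟩, hsingle⟩
  induction x using Finsupp.induction_linear with
  | zero => simp [hA0, sgn_zero]
  | single k a =>
    intro y
    rcases zmod_two_cases a with rfl | rfl
    · simp [hA0, sgn_zero]
    · rw [hsingle, hstep, add_comm]
  | add f g hf hg =>
    intro y
    have h1 : A (f + g) = sgn (orderForm c f g) • (A f * A g) := by
      rw [hf, smul_smul, sgn_mul_self, one_smul]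
    rw [h1, smul_mul_assoc, mul_assoc, hg, mul_smul_comm, hf, smul_smul, smul_smul, map_add,
      map_add, LinearMap.add_apply, sgn_add, sgn_add, ← add_assoc]
    congr 1
    linear_combination sgn (orderForm c f y) * sgn (orderForm c g y) *
      sgn_mul_self (orderForm c f g)

end IsSpinSystem

omit [CompleteSpace H] in
theorem IsIrreducible.of_weyl (hU : IsIrreducible U) {A : Gam → H →L[ℂ] H}
    (hA : ∀ k, A (Finsupp.single k 1) = U k) (M : Submodule ℂ H) (hM : IsClosed (M : Set H))
    (hinv : ∀ x, ∀ ξ ∈ M, A x ξ ∈ M) : M = ⊥ ∨ M = ⊤ :=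
  hU.invariant M hM fun k => hA k ▸ hinv _

end Product

/-! ### Approximate unitary equivalence and central characters -/

theorem infinite_quotient_ker_omega {c : Matrix ℕ ℕ (ZMod 2)}
    (hrank : Cardinal.aleph0 ≤ c.cRank) : Infinite (Gam ⧸ LinearMap.ker (omega c)) := by
  by_contra hfin
  rw [not_infinite_iff_finite] at hfin
  let Ψ : (Gam →ₗ[ZMod 2] ZMod 2) →ₗ[ZMod 2] ℕ → ZMod 2 :=
    LinearMap.pi fun i => LinearMap.applyₗ (Finsupp.single i 1)
  have hle : Submodule.span (ZMod 2) (Set.range c.col) ≤ (LinearMap.range (omega c)).map Ψ := by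
    rw [Submodule.span_le]
    rintro _ ⟨j, rfl⟩
    refine ⟨omega c (Finsupp.single j 1), ⟨_, rfl⟩, ?_⟩
    ext i
    simp [Ψ, omega, Matrix.col]
  have : Finite (LinearMap.range (omega c)) :=
    Finite.of_equiv _ (omega c).quotKerEquivRange.toEquiv
  have hlt : Module.rank (ZMod 2) (LinearMap.range (omega c)) < Cardinal.aleph0 :=
    Module.rank_lt_aleph0 (ZMod 2) _
  exact absurd (hrank.trans ((Submodule.rank_mono hle).trans (rank_map_le _ _))) hlt.not_ge

namespace IrreducibleSpinSystem

variable {c : Matrix ℕ ℕ (ZMod 2)}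

/-- Irreducible spin systems with the same central character are approximately unitarily
equivalent: for every `n` some unitary operator conjugates the first `n` operators of one to those
of the other. -/
theorem equivalent_of_central_eq (hsymm : ∀ i j, c i j = c j i) (hdiag : ∀ i, c i i = 0)
    (hrank : Cardinal.aleph0 ≤ c.cRank) {S : IrreducibleSpinSystem.{u} c}
    {T : IrreducibleSpinSystem.{v} c} {A : Gam → S.H →L[ℂ] S.H} {B : Gam → T.H →L[ℂ] T.H}
    (hA : IsWeylSystem (orderForm c) A) (hAU : ∀ k, A (Finsupp.single k 1) = S.U k)
    (hB : IsWeylSystem (orderForm c) B) (hBU : ∀ k, B (Finsupp.single k 1) = T.U k)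
    {z : Gam → ℂ} (hzA : ∀ x ∈ kerOmega c, A x = z x • 1)
    (hzB : ∀ x ∈ kerOmega c, B x = z x • 1) : S.Equivalent T := by
  have hβ := commForm_orderForm hsymm hdiag
  have hinf := infinite_quotient_ker_omega hrank
  rw [← hβ] at hinf
  have hker : ∀ x, commForm (orderForm c) x = 0 → x ∈ kerOmega c := fun x hx => by
    rwa [hβ] at hx
  have := S.isIrreducible.nontrivial
  have := T.isIrreducible.nontrivial
  have hW : ∀ n : ℕ, ∃ W : S.H ≃ₗᵢ[ℂ] T.H, ∀ k < n, ∀ ξ, W (S.U k ξ) = T.U k (W ξ) := by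
    intro n
    let s : Set Gam := (fun k => Finsupp.single k 1) '' Set.Iio n
    have hs : s.Finite := (Set.finite_Iio n).image _
    have hfin : Finite (Submodule.span (ZMod 2) s) := by
      have := FiniteDimensional.span_of_finite (ZMod 2) hs
      exact Module.finite_of_finite (ZMod 2)
    obtain ⟨W, hW⟩ := hA.exists_intertwiner hB hinf (S.isIrreducible.of_weyl hAU)
      (T.isIrreducible.of_weyl hBU) (fun x hx => hzA x (hker x hx))
      (fun x hx => hzB x (hker x hx)) hfin
    refine ⟨W, fun k hk ξ => ?_⟩
    rw [← hAU, ← hBU]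
    exact hW _ (Submodule.subset_span ⟨k, hk, rfl⟩) ξ
  choose W hW using hW
  refine ⟨W, fun k => tendsto_const_nhds.congr' ?_⟩
  filter_upwards [eventually_gt_atTop k] with n hn
  symm
  rw [norm_eq_zero, sub_eq_zero]
  ext ξ
  simp [hW n k hn]

/-- The central character is an invariant of approximate unitary equivalence. -/
theorem Equivalent.central_eq {S : IrreducibleSpinSystem.{u} c}
    {T : IrreducibleSpinSystem.{v} c} (h : S.Equivalent T) {A : Gam → S.H →L[ℂ] S.H}
    {B : Gam → T.H →L[ℂ] T.H} {β : Gam →ₗ[ZMod 2] Gam →ₗ[ZMod 2] ZMod 2}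
    (hA : IsWeylSystem β A) (hAU : ∀ k, A (Finsupp.single k 1) = S.U k)
    (hB : IsWeylSystem β B) (hBU : ∀ k, B (Finsupp.single k 1) = T.U k)
    {a b : ℂ} {x : Gam} (ha : A x = a • 1) (hb : B x = b • 1) : a = b := by
  obtain ⟨W, hW⟩ := h
  let Φ : ℕ → (S.H →L[ℂ] S.H) → T.H →L[ℂ] T.H := fun n R =>
    (W n : S.H →L[ℂ] T.H) ∘L R ∘L ((W n).symm : T.H →L[ℂ] S.H)
  have hsmul : ∀ n (t : ℂ) R, Φ n (t • R) = t • Φ n R := fun n t R => by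
    ext ξ
    simp [Φ]
  have hmul : ∀ n R R', Φ n (R * R') = Φ n R * Φ n R' := fun n R R' => by
    ext ξ
    simp [Φ]
  have hone : ∀ n, Φ n 1 = 1 := fun n => by
    ext ξ
    simp [Φ]
  have hlim : ∀ y, Tendsto (fun n => Φ n (A y)) atTop (𝓝 (B y)) := by
    intro y
    induction y using Finsupp.induction_linear with
    | zero => simp [hA.map_zero, hB.map_zero, hone]
    | single k e =>
      rcases zmod_two_cases e with rfl | rfl
      · simp [hA.map_zero, hB.map_zero, hone]
      · rw [hAU, hBU, tendsto_iff_norm_sub_tendsto_zero]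
        exact hW k
    | add f g hf hg =>
      simp only [hA.map_add, hB.map_add, hsmul, hmul]
      exact (hf.mul hg).const_smul _
  have hx := hlim x
  simp only [ha, hb, hsmul, hone] at hx
  have heq := tendsto_nhds_unique hx tendsto_const_nhds
  have := T.isIrreducible.nontrivial
  exact (smul_left_injective ℂ (one_ne_zero (α := T.H →L[ℂ] T.H)) heq).symm

theorem functional_eq (γ : ℕ → ZMod 2) (x : Gam) :
    functional γ x = Finsupp.linearCombination (ZMod 2) γ x := by
  simp [functional, Finsupp.linearCombination_apply, Finsupp.sum, mul_comm]

theorem isWeylSystem_phaseShift {S : IrreducibleSpinSystem.{u} c} (γ : ℕ → ZMod 2)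
    {A : Gam → S.H →L[ℂ] S.H} {β : Gam →ₗ[ZMod 2] Gam →ₗ[ZMod 2] ZMod 2}
    (hA : IsWeylSystem β A) (hAU : ∀ k, A (Finsupp.single k 1) = S.U k) :
    ∃ B : Gam → (S.phaseShift γ).H →L[ℂ] (S.phaseShift γ).H, IsWeylSystem β B ∧
      (∀ k, B (Finsupp.single k 1) = (S.phaseShift γ).U k) ∧
      ∀ x (a : ℂ), A x = a • 1 → B x = (sgn (functional γ x) * a) • 1 := by
  have h1 : ∀ k, sgn (Finsupp.linearCombination (ZMod 2) γ (Finsupp.single k 1)) •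
      A (Finsupp.single k 1) = sgn (γ k) • S.U k := fun k => by
    rw [Finsupp.linearCombination_single, one_smul, hAU]
  have h2 : ∀ x (a : ℂ), A x = a • 1 → sgn (Finsupp.linearCombination (ZMod 2) γ x) • A x =
      (sgn (functional γ x) * a) • 1 := fun x a h => by
    rw [h, smul_smul, functional_eq]
  exact ⟨_, hA.sgn_smul (Finsupp.linearCombination (ZMod 2) γ), h1, h2⟩

theorem exists_weyl_central (hsymm : ∀ i j, c i j = c j i) (hdiag : ∀ i, c i i = 0)
    (S : IrreducibleSpinSystem.{u} c) :
    ∃ (A : Gam → S.H →L[ℂ] S.H) (z : Gam → ℂ), IsWeylSystem (orderForm c) A ∧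
      (∀ k, A (Finsupp.single k 1) = S.U k) ∧ ∀ x ∈ kerOmega c, A x = z x • 1 := by
  obtain ⟨A, hA, hAU⟩ := S.isSpinSystem.exists_isWeylSystem
  obtain ⟨z, hz⟩ := hA.exists_central_character (S.isIrreducible.of_weyl hAU)
  refine ⟨A, z, hA, hAU, fun x hx => hz x ?_⟩
  rw [commForm_orderForm hsymm hdiag]
  exact hx

theorem central_sq {S : IrreducibleSpinSystem.{u} c} {A : Gam → S.H →L[ℂ] S.H}
    {β : Gam →ₗ[ZMod 2] Gam →ₗ[ZMod 2] ZMod 2} (hA : IsWeylSystem β A) {x : Gam} {a : ℂ}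
    (ha : A x = a • 1) : a ^ 2 = sgn (β x x) := by
  have := S.isIrreducible.nontrivial
  have h := hA.mul_self x
  rw [ha, smul_mul_smul_comm, one_mul, ← pow_two] at h
  exact smul_left_injective ℂ (one_ne_zero (α := S.H →L[ℂ] S.H)) h

theorem central_add {S : IrreducibleSpinSystem.{u} c} {A : Gam → S.H →L[ℂ] S.H}
    {β : Gam →ₗ[ZMod 2] Gam →ₗ[ZMod 2] ZMod 2} (hA : IsWeylSystem β A) {x y : Gam} {a b d : ℂ}
    (ha : A x = a • 1) (hb : A y = b • 1) (hd : A (x + y) = d • 1) :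
    a * b = sgn (β x y) * d := by
  have := S.isIrreducible.nontrivial
  have h := hA.mul x y
  rw [ha, hb, hd, smul_mul_smul_comm, one_mul, smul_smul] at h
  exact smul_left_injective ℂ (one_ne_zero (α := S.H →L[ℂ] S.H)) h

theorem central_ne_zero {S : IrreducibleSpinSystem.{u} c} {A : Gam → S.H →L[ℂ] S.H}
    {β : Gam →ₗ[ZMod 2] Gam →ₗ[ZMod 2] ZMod 2} (hA : IsWeylSystem β A) {x : Gam} {a : ℂ}
    (ha : A x = a • 1) : a ≠ 0 := by
  intro h
  have h2 := central_sq hA ha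
  rw [h, zero_pow two_ne_zero] at h2
  exact sgn_ne_zero _ h2.symm

theorem exists_functional_extending (N : Submodule (ZMod 2) Gam) (f : N →ₗ[ZMod 2] ZMod 2) :
    ∃ γ : ℕ → ZMod 2, ∀ x : N, functional γ x = f x := by
  obtain ⟨g, hg⟩ := f.exists_extend
  refine ⟨fun k => g (Finsupp.single k 1), fun x => ?_⟩
  rw [functional_eq, ← hg, LinearMap.comp_apply]
  refine congrArg (fun φ : Gam →ₗ[ZMod 2] ZMod 2 => φ x)
    (Finsupp.lhom_ext' fun k => LinearMap.ext_ring ?_)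
  simp

theorem exists_equivalent_phaseShift (hsymm : ∀ i j, c i j = c j i) (hdiag : ∀ i, c i i = 0)
    (hrank : Cardinal.aleph0 ≤ c.cRank) (S : IrreducibleSpinSystem.{u} c)
    (T : IrreducibleSpinSystem.{v} c) : ∃ γ : ℕ → ZMod 2, T.Equivalent (S.phaseShift γ) := by
  obtain ⟨A, z, hA, hAU, hz⟩ := S.exists_weyl_central hsymm hdiag
  obtain ⟨B, t, hB, hBU, ht⟩ := T.exists_weyl_central hsymm hdiag
  -- The two central characters differ by a linear functional on `ker ω`.
  have hf : ∀ x : kerOmega c, ∃ e : ZMod 2, t x = sgn e * z x := fun x =>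
    exists_eq_sgn_mul (by rw [central_sq hB (ht x x.2), central_sq hA (hz x x.2)])
  choose f hf using hf
  have hadd : ∀ x y, f (x + y) = f x + f y := by
    intro x y
    have hxy := (kerOmega c).add_mem x.2 y.2
    have h1 := central_add hB (ht x x.2) (ht y y.2) (ht _ hxy)
    have h2 := central_add hA (hz x x.2) (hz y y.2) (hz _ hxy)
    have h3 := hf (x + y)
    rw [Submodule.coe_add] at h3
    rw [h3, hf x, hf y, mul_mul_mul_comm, h2] at h1
    apply sgn_injective
    rw [sgn_add]
    apply mul_right_cancel₀ (mul_ne_zero (sgn_ne_zero (orderForm c x y))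
      (central_ne_zero hA (hz _ hxy)))
    linear_combination -h1
  obtain ⟨γ, hγ⟩ := exists_functional_extending _ ((AddMonoidHom.mk' f hadd).toZModLinearMap 2)
  obtain ⟨D, hD, hDU, hDz⟩ := isWeylSystem_phaseShift γ hA hAU
  refine ⟨γ, equivalent_of_central_eq hsymm hdiag hrank hB hBU hD hDU ht fun x hx => ?_⟩
  rw [hDz x _ (hz x hx), hγ ⟨x, hx⟩]
  exact congrArg (· • _) (hf ⟨x, hx⟩).symm

theorem phaseShift_equivalent_iff (hsymm : ∀ i j, c i j = c j i) (hdiag : ∀ i, c i i = 0)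
    (hrank : Cardinal.aleph0 ≤ c.cRank) (S : IrreducibleSpinSystem.{u} c) (γ γ' : ℕ → ZMod 2) :
    (S.phaseShift γ).Equivalent (S.phaseShift γ') ↔
      ∀ x ∈ kerOmega c, functional γ x = functional γ' x := by
  obtain ⟨A, z, hA, hAU, hz⟩ := S.exists_weyl_central hsymm hdiag
  obtain ⟨D, hD, hDU, hDz⟩ := isWeylSystem_phaseShift γ hA hAU
  obtain ⟨D', hD', hDU', hDz'⟩ := isWeylSystem_phaseShift γ' hA hAU
  refine ⟨fun h x hx => ?_, fun h => ?_⟩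
  · have h1 := h.central_eq hD hDU hD' hDU' (hDz x _ (hz x hx)) (hDz' x _ (hz x hx))
    exact sgn_injective (mul_right_cancel₀ (central_ne_zero hA (hz x hx)) h1)
  · refine equivalent_of_central_eq hsymm hdiag hrank hD hDU hD' hDU'
      (z := fun x => sgn (functional γ x) * z x) (fun x hx => hDz x _ (hz x hx)) fun x hx => ?_
    rw [h x hx]
    exact hDz' x _ (hz x hx)

end IrreducibleSpinSystem

/-! ### Existence of irreducible spin systems -/

section Shift

variable {M H : Type*} [NormedAddCommGroup H] [InnerProductSpace ℂ H] [CompleteSpace H]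

theorem exists_weighted_permutation {e : M → H} (he : Orthonormal ℂ e)
    (hd : Dense (Submodule.span ℂ (Set.range e) : Set H)) (g : M ≃ M) {α : M → ℂ}
    (hα : ∀ y, ‖α y‖ = 1) : ∃ W : H ≃ₗᵢ[ℂ] H, ∀ y, W (e y) = α y • e (g y) := by
  classical
  have hne : ∀ y, α y ≠ 0 := fun y h => by simpa [h] using hα y
  refine exists_isometryEquiv_of_inner_eq hd (hd.mono (SetLike.coe_subset_coe.2
    (Submodule.span_le.2 ?_))) fun i j => ?_
  · rintro _ ⟨y, rfl⟩
    have h := Submodule.smul_mem (Submodule.span ℂ (Set.range fun y => α y • e (g y)))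
      (α (g.symm y))⁻¹ (Submodule.subset_span ⟨g.symm y, rfl⟩)
    simpa [smul_smul, inv_mul_cancel₀ (hne (g.symm y))] using h
  · rw [inner_smul_left, inner_smul_right, orthonormal_iff_ite.1 he, orthonormal_iff_ite.1 he]
    rcases eq_or_ne i j with rfl | hij
    · simp [Complex.conj_mul', hα]
    · simp [hij]

end Shift

section Induced

variable {E : Type*} [AddCommGroup E] [Module (ZMod 2) E]

/-- A maximal isotropic subspace is the kernel of an idempotent linear map. -/
theorem exists_projection_ker_maximal_isotropic (β : E →ₗ[ZMod 2] E →ₗ[ZMod 2] ZMod 2) :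
    ∃ m : E →ₗ[ZMod 2] E, (∀ x, m (m x) = m x) ∧
      (∀ x y, m x = 0 → m y = 0 → commForm β x y = 0) ∧
      ∀ x, (∀ l, m l = 0 → commForm β x l = 0) → m x = 0 := by
  obtain ⟨L, -, hiso, hmax⟩ :=
    exists_maximal_isotropic (commForm β) (commForm_symm β) (commForm_self β) ⊤
  obtain ⟨p, hp⟩ := L.subtype.exists_leftInverse_of_injective L.ker_subtype
  have hp' : ∀ l : L, p l = l := fun l => LinearMap.congr_fun hp l
  have hm : ∀ x, (LinearMap.id - L.subtype ∘ₗ p : E →ₗ[ZMod 2] E) x = 0 ↔ x ∈ L := by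
    intro x
    simp only [LinearMap.sub_apply, LinearMap.id_apply, LinearMap.comp_apply,
      Submodule.subtype_apply, sub_eq_zero]
    exact ⟨fun h => h ▸ (p x).2, fun h => congrArg Subtype.val (hp' ⟨x, h⟩).symm⟩
  refine ⟨LinearMap.id - L.subtype ∘ₗ p, fun x => ?_, ?_, ?_⟩
  · simp [hp']
  · intro x y hx hy
    exact hiso x ((hm x).1 hx) y ((hm y).1 hy)
  · intro x hx
    exact (hm x).2 (hmax x trivial fun l hl => hx l ((hm l).2 hl))

/-- Let `m` be an idempotent whose kernel is a maximal isotropic subspace. On a Hilbert space with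
an orthonormal basis `e` indexed by the range of `m`, the operators
`e y ↦ s x * (-1) ^ (ω (x - m x) y + β (m x) y) • e (y + m x)`, with `s x` a square root of a sign
that makes the operator an involution, commute up to the signs prescribed by `ω = commForm β`. -/
theorem exists_induced_operators {β : E →ₗ[ZMod 2] E →ₗ[ZMod 2] ZMod 2} {m : E →ₗ[ZMod 2] E}
    (hm : ∀ x, m (m x) = m x) (hiso : ∀ x y, m x = 0 → m y = 0 → commForm β x y = 0)
    {H : Type*} [NormedAddCommGroup H] [InnerProductSpace ℂ H] [CompleteSpace H]
    {e : LinearMap.range m → H} (he : Orthonormal ℂ e)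
    (hd : Dense (Submodule.span ℂ (Set.range e) : Set H)) :
    ∃ T : E → H ≃ₗᵢ[ℂ] H, (∀ x ξ, T x (T x ξ) = ξ) ∧
      (∀ x y ξ, T x (T y ξ) = sgn (commForm β x y) • T y (T x ξ)) ∧
      (∀ x y, ∃ κ : ℂ, ∀ ξ, T (x + y) ξ = κ • T x (T y ξ)) ∧
      (∃ κ : ℂ, ∀ ξ, T 0 ξ = κ • ξ) ∧
      (∀ y : LinearMap.range m, ∃ κ : ℂ, e y = κ • T y (e 0)) ∧
      ∀ l, m l = 0 → ∃ s : ℂ, ‖s‖ = 1 ∧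
        ∀ y : LinearMap.range m, T l (e y) = (s * sgn (commForm β l y)) • e y := by
  let ψ : E →ₗ[ZMod 2] E →ₗ[ZMod 2] ZMod 2 :=
    commForm β ∘ₗ (LinearMap.id - m) + β ∘ₗ m
  have hψ : ∀ x y, ψ x y = commForm β (x - m x) y + β (m x) y := fun x y => rfl
  have hψcomm : ∀ x y, ψ x (m y) + ψ y (m x) = commForm β x y := by
    intro x y
    have h0 := hiso (x - m x) (y - m y) (by rw [map_sub, hm, sub_self])
      (by rw [map_sub, hm, sub_self])
    simp only [hψ, map_sub, LinearMap.sub_apply] at h0 ⊢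
    rw [commForm_symm β y (m x), commForm_symm β (m y) (m x)]
    have h1 := commForm_apply β (m x) (m y)
    linear_combination -h0 - h1
  have hs : ∀ x, ∃ s : ℂ, s ^ 2 = sgn (ψ x (m x)) := fun x =>
    IsAlgClosed.exists_pow_nat_eq _ zero_lt_two
  choose s hs using hs
  have hsnorm : ∀ x, ‖s x‖ = 1 := fun x => by
    have h := congrArg norm (hs x)
    rw [norm_pow, norm_sgn] at h
    exact (pow_eq_one_iff_of_nonneg (norm_nonneg _) two_ne_zero).1 h
  have hs0 : ∀ x, s x ≠ 0 := fun x h => by simpa [h] using hsnorm x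
  let q : E → LinearMap.range m := fun x => ⟨m x, x, rfl⟩
  have hT : ∀ x, ∃ W : H ≃ₗᵢ[ℂ] H, ∀ y, W (e y) = (s x * sgn (ψ x y)) • e (y + q x) := fun x =>
    exists_weighted_permutation he hd (Equiv.addRight (q x)) fun y => by
      rw [norm_mul, hsnorm, norm_sgn, one_mul]
  choose T hT using hT
  have hext : ∀ {f g : H →L[ℂ] H}, (∀ y, f (e y) = g (e y)) → ∀ ξ, f ξ = g ξ := by
    intro f g h ξ
    have : f = g := ContinuousLinearMap.ext_on hd (by rintro _ ⟨y, rfl⟩; exact h y)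
    rw [this]
  have hTT : ∀ x x' y, T x (T x' (e y)) =
      (s x * s x' * sgn (ψ x y) * sgn (ψ x' y) * sgn (ψ x (m x'))) • e (y + q x' + q x) := by
    intro x x' y
    rw [hT, map_smul, hT, smul_smul, Submodule.coe_add, map_add, sgn_add]
    congr 1
    ring
  have hq : ∀ x y, q (x + y) = q y + q x := fun x y => by
    ext
    simp [q, add_comm]
  refine ⟨T, fun x ξ => ?_, fun x x' ξ => ?_, fun x x' => ?_, ⟨s 0, fun ξ => ?_⟩, fun y => ?_,
    fun l hl => ⟨s l, hsnorm l, fun y => ?_⟩⟩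
  · refine hext (f := (T x : H →L[ℂ] H) ∘L (T x : H →L[ℂ] H)) (g := 1) (fun y => ?_) ξ
    simp only [ContinuousLinearMap.comp_apply, one_apply_eq_self]
    refine (hTT x x y).trans ?_
    rw [add_assoc, add_self_eq_zero_of_zmod_two, add_zero]
    have h1 := hs x
    have h2 := sgn_mul_self (ψ x y)
    have h3 := sgn_mul_self (ψ x (m x))
    have h4 : s x * s x * sgn (ψ x y) * sgn (ψ x y) * sgn (ψ x (m x)) = 1 := by
      linear_combination sgn (ψ x y) * sgn (ψ x y) * sgn (ψ x (m x)) * h1 +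
        sgn (ψ x (m x)) * sgn (ψ x (m x)) * h2 + h3
    rw [h4, one_smul]
  · refine hext (f := (T x : H →L[ℂ] H) ∘L (T x' : H →L[ℂ] H))
      (g := sgn (commForm β x x') • (T x' : H →L[ℂ] H) ∘L (T x : H →L[ℂ] H)) (fun y => ?_) ξ
    refine (hTT x x' y).trans (Eq.trans ?_ (congrArg (sgn (commForm β x x') • ·)
      (hTT x' x y).symm))
    rw [smul_smul, ← hψcomm, sgn_add, add_right_comm]
    congr 1
    linear_combination -(s x * s x' * sgn (ψ x y) * sgn (ψ x' y) * sgn (ψ x (m x'))) *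
      sgn_mul_self (ψ x' (m x))
  · refine ⟨s (x + x') * (s x)⁻¹ * (s x')⁻¹ * sgn (ψ x (m x')), fun ξ => ?_⟩
    refine hext (f := (T (x + x') : H →L[ℂ] H)) (g := (s (x + x') * (s x)⁻¹ * (s x')⁻¹ *
      sgn (ψ x (m x'))) • (T x : H →L[ℂ] H) ∘L (T x' : H →L[ℂ] H)) (fun y => ?_) ξ
    refine (hT (x + x') y).trans (Eq.trans ?_ (congrArg (fun w : H => (s (x + x') *
      (s x)⁻¹ * (s x')⁻¹ * sgn (ψ x (m x'))) • w) (hTT x x' y).symm))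
    rw [smul_smul, map_add, LinearMap.add_apply, sgn_add, hq, ← add_assoc]
    congr 1
    have h1 := mul_inv_cancel₀ (hs0 x)
    have h2 := mul_inv_cancel₀ (hs0 x')
    have h3 := sgn_mul_self (ψ x (m x'))
    linear_combination -(s (x + x') * sgn (ψ x y) * sgn (ψ x' y)) *
      (s x' * (s x')⁻¹ * sgn (ψ x (m x')) ^ 2 * h1 + sgn (ψ x (m x')) ^ 2 * h2 + h3)
  · refine hext (f := (T 0 : H →L[ℂ] H)) (g := s 0 • 1) (fun y => ?_) ξ
    refine (hT 0 y).trans ?_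
    have : q 0 = 0 := by ext; simp [q]
    simp [this, sgn_zero]
  · refine ⟨(s y)⁻¹, ?_⟩
    have hy : q y = y := by
      obtain ⟨_, x, rfl⟩ := y
      ext
      exact hm x
    rw [hT, hy, zero_add, Submodule.coe_zero, map_zero, sgn_zero, mul_one, smul_smul,
      inv_mul_cancel₀ (hs0 _), one_smul]
  · have hq0 : q l = 0 := by
      ext
      exact hl
    rw [hT, hq0, add_zero, hψ, hl, sub_zero, map_zero, LinearMap.zero_apply, add_zero]

/-- A closed subspace that is invariant under the induced operators is trivial: the orthogonal
projection onto it commutes with these operators, the vector `e 0` is determined up to a scalar by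
being a joint eigenvector of the operators of the maximal isotropic subspace, and its translates
are total. -/
theorem induced_irreducible {β : E →ₗ[ZMod 2] E →ₗ[ZMod 2] ZMod 2} {m : E →ₗ[ZMod 2] E}
    (hm : ∀ x, m (m x) = m x)
    (hmax : ∀ x, (∀ l, m l = 0 → commForm β x l = 0) → m x = 0)
    {H : Type*} [NormedAddCommGroup H] [InnerProductSpace ℂ H] [CompleteSpace H]
    {e : LinearMap.range m → H} (he : Orthonormal ℂ e)
    (hd : Dense (Submodule.span ℂ (Set.range e) : Set H)) {T : E → H ≃ₗᵢ[ℂ] H}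
    (hinvol : ∀ x ξ, T x (T x ξ) = ξ)
    (htrans : ∀ y : LinearMap.range m, ∃ κ : ℂ, e y = κ • T y (e 0))
    (hdiag : ∀ l, m l = 0 → ∃ s : ℂ, ‖s‖ = 1 ∧
        ∀ y : LinearMap.range m, T l (e y) = (s * sgn (commForm β l y)) • e y)
    {N : Submodule ℂ H} (hN : IsClosed (N : Set H)) (hinv : ∀ x, ∀ ξ ∈ N, T x ξ ∈ N) :
    N = ⊥ ∨ N = ⊤ := by
  have : CompleteSpace N := hN.completeSpace_coe
  let P := N.starProjection
  have hPT : ∀ x ξ, P (T x ξ) = T x (P ξ) := by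
    intro x ξ
    refine Submodule.eq_starProjection_of_mem_orthogonal
      (hinv x _ (N.starProjection_apply_mem ξ)) ?_
    rw [← map_sub, Submodule.mem_orthogonal]
    intro η hη
    rw [← LinearIsometryEquiv.inner_map_map (T x), hinvol]
    exact (Submodule.mem_orthogonal _ _).1 (N.sub_starProjection_mem_orthogonal ξ) _ (hinv x η hη)
  have horth : ∀ y, y ≠ 0 → inner ℂ (e y) (P (e 0)) = 0 := by
    intro y hy
    obtain ⟨l, hl, hne⟩ : ∃ l, m l = 0 ∧ commForm β (y : E) l ≠ 0 := by
      by_contra! hcon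
      have h0 := hmax y hcon
      obtain ⟨_, x, rfl⟩ := y
      exact hy (Subtype.ext ((hm x).symm.trans h0))
    obtain ⟨s, hs, hle⟩ := hdiag l hl
    have h1 := LinearIsometryEquiv.inner_map_map (T l) (e y) (P (e 0))
    rw [← hPT, hle, hle, map_smul, inner_smul_left, inner_smul_right, commForm_symm,
      (zmod_two_cases _).resolve_left hne, sgn_one, Submodule.coe_zero, map_zero, sgn_zero] at h1
    have h2 : (starRingEnd ℂ) s * s = 1 := by simp [Complex.conj_mul', hs]
    simp only [map_mul, map_neg, map_one] at h1
    linear_combination (-1 / 2 : ℂ) * h1 - (1 / 2 : ℂ) * inner ℂ (e y) (P (e 0)) * h2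
  set a : ℂ := inner ℂ (e 0) (P (e 0)) with ha
  -- All coordinates of `P (e 0)` other than the one at `0` vanish.
  have hPe : P (e 0) = a • e 0 := by
    refine hd.eq_of_inner_right ℂ fun ξ hξ => ?_
    induction hξ using Submodule.span_induction with
    | mem ξ h =>
      obtain ⟨y, rfl⟩ := h
      rcases eq_or_ne y 0 with rfl | hy
      · rw [inner_smul_right, inner_self_eq_norm_sq_to_K, he.1 0]
        simp [ha]
      · rw [horth y hy, inner_smul_right, he.2 hy, mul_zero]
    | zero => simp
    | add ξ η _ _ h h' => rw [inner_add_left, inner_add_left, h, h']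
    | smul b ξ _ h => rw [inner_smul_left, inner_smul_left, h]
  have hP : P = a • 1 := by
    refine ContinuousLinearMap.ext_on hd ?_
    rintro _ ⟨y, rfl⟩
    obtain ⟨κ, hκ⟩ := htrans y
    rw [hκ, map_smul, hPT, hPe, map_smul, smul_apply, one_apply_eq_self, smul_comm]
  have hPN : ∀ ξ, a • ξ ∈ N := fun ξ => by
    have h := N.starProjection_apply_mem ξ
    rwa [show N.starProjection ξ = a • ξ from congrArg (fun R : H →L[ℂ] H => R ξ) hP] at h
  rcases eq_or_ne a 0 with h0 | h0
  · left
    rw [eq_bot_iff]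
    intro ξ hξ
    have h1 := Submodule.starProjection_eq_self_iff.2 hξ
    rw [show N.starProjection ξ = a • ξ from congrArg (fun R : H →L[ℂ] H => R ξ) hP, h0,
      zero_smul] at h1
    exact h1.symm
  · right
    rw [eq_top_iff]
    intro ξ _
    have h := N.smul_mem a⁻¹ (hPN ξ)
    rwa [smul_smul, inv_mul_cancel₀ h0, one_smul] at h

end Induced

/-- The operators induced from a maximal isotropic subspace, at the vectors of the standard basis,
form an irreducible spin system. -/
theorem exists_isSpinSystem_of_orthonormal {c : Matrix ℕ ℕ (ZMod 2)}
    (hsymm : ∀ i j, c i j = c j i) (hdiag : ∀ i, c i i = 0) {m : Gam →ₗ[ZMod 2] Gam}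
    (hm : ∀ x, m (m x) = m x)
    (hiso : ∀ x y, m x = 0 → m y = 0 → commForm (orderForm c) x y = 0)
    (hmax : ∀ x, (∀ l, m l = 0 → commForm (orderForm c) x l = 0) → m x = 0)
    {H : Type*} [NormedAddCommGroup H] [InnerProductSpace ℂ H] [CompleteSpace H]
    {e : LinearMap.range m → H} (he : Orthonormal ℂ e)
    (hd : Dense (Submodule.span ℂ (Set.range e) : Set H)) :
    ∃ U : ℕ → H →L[ℂ] H, IsSpinSystem c U ∧ IsIrreducible U := by
  obtain ⟨T, hinvol, hcomm, hadd, hzero, htrans, hdiagT⟩ := exists_induced_operators hm hiso he hd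
  have hsa : ∀ x, IsSelfAdjoint (T x : H →L[ℂ] H) := fun x => by
    rw [ContinuousLinearMap.isSelfAdjoint_iff_isSymmetric]
    intro ξ η
    refine Eq.trans ?_ (LinearIsometryEquiv.inner_map_map (T x) ξ (T x η))
    rw [hinvol]
    rfl
  have hsq : ∀ x, (T x : H →L[ℂ] H) * (T x : H →L[ℂ] H) = 1 := fun x =>
    ContinuousLinearMap.ext fun ξ => hinvol x ξ
  refine ⟨fun k => (T (Finsupp.single k 1) : H →L[ℂ] H), ⟨fun k => hsa _, fun k => ?_,
    fun i j => ?_⟩, ⟨⟨_, 0, he.ne_zero 0⟩, fun N hN hinv => ?_⟩⟩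
  · rw [Unitary.mem_iff, (hsa _).star_eq]
    exact ⟨hsq _, hsq _⟩
  · refine ContinuousLinearMap.ext fun ξ => ?_
    have h := hcomm (Finsupp.single i 1) (Finsupp.single j 1) ξ
    rw [commForm_orderForm hsymm hdiag] at h
    have hij : omega c (Finsupp.single i 1) (Finsupp.single j 1) = c i j := by
      simp [omega, hsymm i j]
    rw [hij] at h
    exact h
  · have h0 : ∀ ξ ∈ N, T 0 ξ ∈ N := by
      obtain ⟨κ, hκ⟩ := hzero
      intro ξ hξ
      rw [hκ]
      exact N.smul_mem _ hξ
    refine induced_irreducible hm hmax he hd hinvol htrans hdiagT hN fun x => ?_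
    induction x using Finsupp.induction_linear with
    | zero => exact h0
    | single k a =>
      rcases zmod_two_cases a with rfl | rfl
      · rw [Finsupp.single_zero]
        exact h0
      · exact hinv k
    | add f g hf hg =>
      obtain ⟨κ, hκ⟩ := hadd f g
      intro ξ hξ
      rw [hκ]
      exact N.smul_mem _ (hf _ (hg _ hξ))

theorem nonempty_irreducibleSpinSystem {c : Matrix ℕ ℕ (ZMod 2)} (hsymm : ∀ i j, c i j = c j i)
    (hdiag : ∀ i, c i i = 0) : Nonempty (IrreducibleSpinSystem.{u} c) := by
  obtain ⟨m, hm, hiso, hmax⟩ := exists_projection_ker_maximal_isotropic (orderForm c)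
  let b : HilbertBasis (ULift.{u} (LinearMap.range m)) ℂ
      (lp (fun _ : ULift.{u} (LinearMap.range m) => ℂ) 2) :=
    HilbertBasis.ofRepr (LinearIsometryEquiv.refl ℂ _)
  have he : Orthonormal ℂ (b ∘ ULift.up) := b.orthonormal.comp _ ULift.up_injective
  have hd : Dense (Submodule.span ℂ (Set.range (b ∘ ULift.up)) : Set
      (lp (fun _ : ULift.{u} (LinearMap.range m) => ℂ) 2)) := by
    rw [ULift.up_surjective.range_comp, Submodule.dense_iff_topologicalClosure_eq_top]
    exact b.dense_span
  obtain ⟨U, hU, hirr⟩ := exists_isSpinSystem_of_orthonormal hsymm hdiag hm hiso hmax he hd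
  exact ⟨⟨_, U, hU, hirr⟩⟩

/-! ### Counting equivalence classes -/

namespace IrreducibleSpinSystem

/-- The phase shifts of one irreducible spin system put the equivalence classes in bijection with
the linear functionals on `ker ω`. -/
theorem mk_classes_eq {c : Matrix ℕ ℕ (ZMod 2)} (hsymm : ∀ i j, c i j = c j i)
    (hdiag : ∀ i, c i i = 0) (hrank : Cardinal.aleph0 ≤ c.cRank) :
    Cardinal.mk (Classes.{u} c) =
      Cardinal.lift.{u + 1} (Cardinal.mk (kerOmega c →ₗ[ZMod 2] ZMod 2)) := by
  obtain ⟨S⟩ := nonempty_irreducibleSpinSystem.{u} hsymm hdiag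
  choose γ hγ using exists_functional_extending (kerOmega c)
  let Φ : (kerOmega c →ₗ[ZMod 2] ZMod 2) → Classes.{u} c := fun f =>
    Quotient.mk (setoid c) (S.phaseShift (γ f))
  have hinj : Function.Injective Φ := by
    intro f g h
    have h1 := (phaseShift_equivalent_iff hsymm hdiag hrank S _ _).1 (Quotient.exact h)
    refine LinearMap.ext fun x => ?_
    rw [← hγ f x, ← hγ g x, h1 x x.2]
  have hsurj : Function.Surjective Φ := by
    intro t
    induction t using Quotient.inductionOn with
    | _ T =>
      obtain ⟨δ, hδ⟩ := exists_equivalent_phaseShift hsymm hdiag hrank S T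
      let f : kerOmega c →ₗ[ZMod 2] ZMod 2 :=
        Finsupp.linearCombination (ZMod 2) δ ∘ₗ (kerOmega c).subtype
      refine ⟨f, Quotient.sound (s := setoid c) ?_⟩
      refine Equivalent.trans ?_ hδ.symm
      refine (phaseShift_equivalent_iff hsymm hdiag hrank S _ _).2 fun x hx => ?_
      rw [hγ f ⟨x, hx⟩, functional_eq]
      rfl
  have := Cardinal.mk_congr_lift (Equiv.ofBijective Φ ⟨hinj, hsurj⟩)
  rw [Cardinal.lift_id'.{0, u + 1}] at this
  exact this.symm

end IrreducibleSpinSystem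

theorem mk_dual_of_rank_eq {V : Type} [AddCommGroup V] [Module (ZMod 2) V] {d : ℕ}
    (h : Module.rank (ZMod 2) V = d) : Cardinal.mk (V →ₗ[ZMod 2] ZMod 2) = 2 ^ d := by
  have : Module.Finite (ZMod 2) V := by
    rw [← Module.rank_lt_aleph0_iff, h]
    exact Cardinal.natCast_lt_aleph0
  have hd : Module.finrank (ZMod 2) (V →ₗ[ZMod 2] ZMod 2) = d := by
    rw [Subspace.dual_finrank_eq]
    exact Module.finrank_eq_of_rank_eq h
  have := Module.finite_of_finite (ZMod 2) (M := V →ₗ[ZMod 2] ZMod 2)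
  have := Module.natCard_eq_pow_finrank (K := ZMod 2) (V := V →ₗ[ZMod 2] ZMod 2)
  rw [hd, Nat.card_zmod] at this
  rw [← Nat.cast_card, this]
  simp

theorem mk_dual_of_aleph0_le_rank {V : Type} [AddCommGroup V] [Module (ZMod 2) V] [Countable V]
    (h : Cardinal.aleph0 ≤ Module.rank (ZMod 2) V) :
    Cardinal.mk (V →ₗ[ZMod 2] ZMod 2) = Cardinal.continuum := by
  let b := Module.Basis.ofVectorSpace (ZMod 2) V
  have hb : Cardinal.mk (Module.Basis.ofVectorSpaceIndex (ZMod 2) V) = Cardinal.aleph0 := by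
    refine le_antisymm Cardinal.mk_le_aleph0 ?_
    rw [b.mk_eq_rank'']
    exact h
  rw [← Cardinal.mk_congr (b.constr (ZMod 2) (M' := ZMod 2)).toEquiv, ← Cardinal.power_def, hb]
  rw [Cardinal.mk_fintype, ZMod.card]
  simp

end SpinSystem

theorem theoremC (c : Matrix ℕ ℕ (ZMod 2)) (hsymm : ∀ i j, c i j = c j i)
    (hdiag : ∀ i, c i i = 0) (hrank : Cardinal.aleph0 ≤ c.cRank) :
    (∀ S : SpinSystem.IrreducibleSpinSystem.{u} c,
      (∀ T : SpinSystem.IrreducibleSpinSystem.{v} c,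
        ∃ γ : ℕ → ZMod 2, T.Equivalent (S.phaseShift γ)) ∧
      (∀ γ γ' : ℕ → ZMod 2,
        (S.phaseShift γ).Equivalent (S.phaseShift γ') ↔
          ∀ x ∈ SpinSystem.kerOmega c,
            SpinSystem.functional γ x = SpinSystem.functional γ' x)) ∧
    (∀ d : ℕ, Module.rank (ZMod 2) (SpinSystem.kerOmega c) = d →
      Cardinal.mk (SpinSystem.IrreducibleSpinSystem.Classes.{u} c) = 2 ^ d) ∧
    (Cardinal.aleph0 ≤ Module.rank (ZMod 2) (SpinSystem.kerOmega c) →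
      Cardinal.mk (SpinSystem.IrreducibleSpinSystem.Classes.{u} c) = Cardinal.continuum) := by
  have hclasses := SpinSystem.IrreducibleSpinSystem.mk_classes_eq.{u} hsymm hdiag hrank
  refine ⟨fun S => ⟨S.exists_equivalent_phaseShift hsymm hdiag hrank,
    S.phaseShift_equivalent_iff hsymm hdiag hrank⟩, fun d hd => ?_, fun hinf => ?_⟩
  · rw [hclasses, SpinSystem.mk_dual_of_rank_eq hd]
    rw [← Cardinal.power_natCast, Cardinal.lift_power]
    simp
  · rw [hclasses, SpinSystem.mk_dual_of_aleph0_le_rank hinf, Cardinal.lift_continuum]
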